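/- **Conventions.** In a groupoid write $\square$ for composition (right to left), $f^{\boxminus}$ for the inverse of $f$; $\mathrm{Comp}(G)$ is the set of components (isomorphism classes of objects) of $G$, and, if $G$ has a chosen object $0$, $\mathrm{Star}(G)$ is the set of morphisms of $G$ with target $0$. A *$2$-track groupoid* $G=(G_{(1)},G_{(2)})$ consists of two groupoids, each with a chosen object $0$; isomorphisms of groups $\psi_a\colon \mathrm{Aut}(a)\cong \mathrm{Aut}(0)$, one for each object $a$ of $G_{(2)}$, with $\psi_a(f^{\boxminus}\,\square\,\alpha\,\square\,f)=\psi_b(\alpha)$ for all $f\colon a\to b$ and $\alpha\in\mathrm{Aut}(b)$; and a function $q\colon \mathrm{Ob}\,G_{(2)}\to \mathrm{Star}(G_{(1)})$ with $q(0)=\mathrm{id}_0$ which is constant on components and induces a bijection $\mathrm{Comp}(G_{(2)})\cong\mathrm{Star}(G_{(1)})$. A *morphism* $F\colon G\to G'$ is a pair of functors $F_{(i)}\colon G_{(i)}\to G'_{(i)}$ preserving the chosen objects, with $\psi_{F_{(2)}a}\circ F_{(2)}=F_{(2)}\circ\psi_a$ on $\mathrm{Aut}(a)$ and $q\circ F_{(2)}=F_{(1)}\circ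 q$. A *pointed bigroupoid* is a bicategory in which all $2$-morphisms are invertible and all $1$-morphisms are invertible up to $2$-isomorphism, with a chosen object $x_0$. A *morphism* of pointed bigroupoids $(B,x_0)\to(B',x_0')$ is a homomorphism of bicategories (pseudofunctor) $F$ with $F(x_0)=x_0'$ and $F(c_{x_0})=c_{x_0'}$, where $c_x$ denotes the identity $1$-morphism of $x$. The composition of $1$-morphisms is written $\bullet$ (right to left). For a topological space $X$, the *homotopy bigroupoid* $\Pi_2^{\mathrm{BiGpd}}(X)$ has as objects the points of $X$, as $1$-morphisms $x\to y$ the paths $I\to X$ from $x$ to $y$, composed by concatenation, with the constant paths as identities, and as $2$-morphisms $p\Rightarrow p'$ the homotopies from $p$ to $p'$ relative to end points, modulo homotopy relative to the boundary of $I^2$; the compositions are the usual vertical and horizontal compositions of homotopies and the coherence $2$-isomorphisms are given by the usual reparametrization homotopies. It is pointed by the basepoint if $X$ is pointed, and is functorial in pointed continuous maps. For a pointed space $(X,0)$, the *fundamental $2$-track groupoid* $\Pi_{(1,2)}(X)=(\Pi_{(1)}(X),\Pi_{(2)}(X))$ is defined as follows. $\Pi_{(1)}(X)$ is the fundamental groupoid,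 with the basepoint as chosen object. The objects of $\Pi_{(2)}(X)$ are the left paths, that is, the paths $a\colon I\to X$ with $a(1)=0$; the chosen object is the constant one. The morphisms from $a$ to $b$ are the classes, relative to the boundary $\partial I^2$, of maps $\alpha\colon I^2\to X$ with $\alpha(1,t)=\alpha(t,1)=0$, $\alpha(0,t)=a(t)$ and $\alpha(t,0)=b(t)$. For $\alpha\colon a\to b$ and $\beta\colon b\to c$, the composite $\beta\,\square\,\alpha$ is the class of $f\circ w$, where $f\colon[0,1]\times[-1,1]\to X$ is $\alpha(s,t)$ for $t\ge0$ and $\beta(-t,s)$ for $t\le0$, and $w\colon I^2\to[0,1]\times[-1,1]$ satisfies $w(qy)=q\,w(y)$ for $q \in I$ and $y$ on the right or upper edge of $I^2$, and is on these edges piecewise linear with $(0,1)\mapsto(0,1)$, $(\frac12,1)\mapsto(1,1)$, $(1,1)\mapsto(1,0)$, $(1,\frac12)\mapsto(1,-1)$, $(1,0)\mapsto(0,-1)$. The identity $\mathrm{id}_a^\square$ is the class of $qy\mapsto a(q)$; inverses are given by interchanging the two coordinates. The map $\psi_a^{-1}\colon\mathrm{Aut}(0)\to\mathrm{Aut}(a)$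 sends $\alpha$ to the class of the map obtained by attaching the lower left corner of $\alpha$ to the upper right corner of $\mathrm{id}_a^\square$, extended by the basepoint. Finally $q(a)$ is the class of the path $a$ in $\mathrm{Star}(\Pi_{(1)}(X))$. A pointed map acts by composition, which makes $\Pi_{(1,2)}$ a functor from pointed spaces to $2$-track groupoids. **Proposition.** 1. There is a forgetful functor $U$ from pointed bigroupoids to $2$-track groupoids, given as follows. For a pointed bigroupoid $(B,x_0)$, $UB_{(1)}=\pi_0B$ is the groupoid with the objects of $B$ and with $\mathrm{Hom}(x,y)=\mathrm{Comp}\,B(x,y)$, with chosen object $x_0$; $UB_{(2)}=\coprod_{x\in\mathrm{Ob}(B)}B(x,x_0)$, with chosen object $c_{x_0}$; the function $q$ sends a $1$-morphism $a\colon x\to x_0$ to its component; and the structural isomorphisms $\psi_a$ are determined by $$\psi_a^{-1}(\alpha)=\lambda\,\square\,(\alpha\bullet\mathrm{id}_a^{\square})\,\square\,\lambda^{\boxminus}\qquad(\alpha\in\mathrm{Aut}(c_{x_0})),$$ where $\lambda\colon c_{x_0}\bullet a\Rightarrow a$ is the left identity coherence $2$-isomorphism. On morphisms, $UF$ is induced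 by the maps of $F$ on objects, $1$-morphisms and $2$-morphisms. 2. The functors $X\mapsto\Pi_{(1,2)}(X)$ and $X\mapsto U\,\Pi_2^{\mathrm{BiGpd}}(X)$ from pointed topological spaces to $2$-track groupoids are naturally isomorphic. -/

import Mathlib

open CategoryTheory Bicategory

universe u

/-! ### 2-track groupoids -/

/-- The set of components (isomorphism classes of objects) of a groupoid. -/
def GroupoidComp (G : Type u) [Category.{u} G] : Type u := Quotient (isIsomorphicSetoid G)

/-- The star of a pointed groupoid: all morphisms with target the basepoint. -/
def GroupoidStar (G : Type u) [Groupoid.{u} G] (pt : G) : Type u := Σ x : G, (x ⟶ pt)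

/-- The map induced on stars by a pointed functor. -/
def GroupoidStar.map {G H : Type u} [Groupoid.{u} G] [Groupoid.{u} H] {p : G} {q : H}
    (F : G ⥤ H) (h : F.obj p = q) (f : GroupoidStar G p) : GroupoidStar H q :=
  ⟨F.obj f.1, F.map f.2 ≫ eqToHom h⟩

/-- A strictly abelian structure on a pointed groupoid: isomorphisms `ψ x : Aut(x) ≅ Aut(0)`
compatible with all change-of-basepoint isomorphisms. -/
structure StrictlyAbelian (G : Type u) [Groupoid.{u} G] (pt : G) where
  psi : ∀ x : G, (x ⟶ x) ≃* (pt ⟶ pt)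
  psi_conj : ∀ {x y : G} (f : x ⟶ y) (α : y ⟶ y),
    psi x (f ≫ α ≫ Groupoid.inv f) = psi y α

/-- A 2-track groupoid. -/
structure TwoTrackGroupoid : Type (u + 1) where
  G₁ : Type u
  [grpd₁ : Groupoid.{u} G₁]
  pt₁ : G₁
  G₂ : Type u
  [grpd₂ : Groupoid.{u} G₂]
  pt₂ : G₂
  strictlyAbelian : StrictlyAbelian G₂ pt₂
  q : G₂ → GroupoidStar G₁ pt₁
  q_pt : q pt₂ = ⟨pt₁, 𝟙 pt₁⟩
  q_const : ∀ a b : G₂, IsIsomorphic a b → q a = q b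
  q_bijective : Function.Bijective
    (Quotient.lift q q_const : GroupoidComp G₂ → GroupoidStar G₁ pt₁)

namespace TwoTrackGroupoid

attribute [instance] grpd₁ grpd₂

/-- The structural isomorphism `ψ`. -/
abbrev psi (G : TwoTrackGroupoid.{u}) (a : G.G₂) : (a ⟶ a) ≃* (G.pt₂ ⟶ G.pt₂) :=
  G.strictlyAbelian.psi a

/-- A morphism of 2-track groupoids. -/
@[ext]
structure Hom (G H : TwoTrackGroupoid.{u}) : Type u where
  F₁ : G.G₁ ⥤ H.G₁
  F₂ : G.G₂ ⥤ H.G₂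
  pt₁ : F₁.obj G.pt₁ = H.pt₁
  pt₂ : F₂.obj G.pt₂ = H.pt₂
  map_psi : ∀ (a : G.G₂) (f : a ⟶ a),
    H.psi (F₂.obj a) (F₂.map f) = eqToHom pt₂.symm ≫ F₂.map (G.psi a f) ≫ eqToHom pt₂
  map_q : ∀ a : G.G₂, H.q (F₂.obj a) = (G.q a).map F₁ pt₁

/-- The identity morphism. -/
def Hom.id (G : TwoTrackGroupoid.{u}) : Hom G G where
  F₁ := 𝟭 _
  F₂ := 𝟭 _
  pt₁ := rfl
  pt₂ := rfl
  map_psi a f := by simp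
  map_q a := Sigma.ext rfl (heq_of_eq (by simp [GroupoidStar.map]))

/-- Composition of morphisms. -/
def Hom.comp {G H K : TwoTrackGroupoid.{u}} (F : Hom G H) (F' : Hom H K) : Hom G K where
  F₁ := F.F₁ ⋙ F'.F₁
  F₂ := F.F₂ ⋙ F'.F₂
  pt₁ := by simp [F.pt₁, F'.pt₁]
  pt₂ := by simp [F.pt₂, F'.pt₂]
  map_psi a f := by
    have h := F'.map_psi _ (F.F₂.map f)
    rw [F.map_psi a f] at h
    simpa [eqToHom_map] using h
  map_q a := by
    have h := F'.map_q (F.F₂.obj a)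
    rw [F.map_q a] at h
    simpa [GroupoidStar.map, eqToHom_map] using h

/-- The category of 2-track groupoids. -/
instance : Category.{u} TwoTrackGroupoid.{u} where
  Hom := Hom
  id := Hom.id
  comp := Hom.comp
  id_comp _ := rfl
  comp_id _ := rfl
  assoc _ _ _ := rfl

@[ext]
theorem hom_ext {G H : TwoTrackGroupoid.{u}} {F F' : G ⟶ H} (h₁ : Hom.F₁ F = Hom.F₁ F')
    (h₂ : Hom.F₂ F = Hom.F₂ F') : F = F' :=
  Hom.ext h₁ h₂

end TwoTrackGroupoid

/-! ### Bigroupoids -/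

/-- A bigroupoid is a bicategory all of whose 2-morphisms are invertible and all of whose
1-morphisms are invertible up to 2-isomorphism. -/
class IsBigroupoid (B : Type u) [Bicategory.{u, u} B] : Prop where
  isGroupoid : ∀ x y : B, IsGroupoid (x ⟶ y)
  exists_inverse : ∀ {x y : B} (f : x ⟶ y), ∃ g : y ⟶ x,
    Nonempty (f ≫ g ≅ 𝟙 x) ∧ Nonempty (g ≫ f ≅ 𝟙 y)

attribute [instance] IsBigroupoid.isGroupoid

/-- A pointed bigroupoid: a bigroupoid with a chosen object. -/
structure PointedBigroupoid : Type (u + 1) where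
  carrier : Type u
  [bicategory : Bicategory.{u, u} carrier]
  [isBigroupoid : IsBigroupoid carrier]
  pt : carrier

namespace PointedBigroupoid

attribute [instance] bicategory isBigroupoid

/-- Morphisms of pointed bigroupoids: homomorphisms of bicategories (pseudofunctors) which preserve
the chosen object and its identity 1-morphism. -/
@[ext]
structure Hom (B C : PointedBigroupoid.{u}) : Type u where
  toPseudofunctor : Pseudofunctor B.carrier C.carrier
  obj_pt : toPseudofunctor.obj B.pt = C.pt
  map_id_pt : toPseudofunctor.map (𝟙 B.pt) = 𝟙 (toPseudofunctor.obj B.pt)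

theorem pseudofunctor_ext {B C : Type u} [Bicategory.{u, u} B] [Bicategory.{u, u} C]
    {F G : Pseudofunctor B C} (h : F.toPrelaxFunctor = G.toPrelaxFunctor)
    (h₁ : HEq F.mapId G.mapId) (h₂ : HEq (@Pseudofunctor.mapComp _ _ _ _ F)
      (@Pseudofunctor.mapComp _ _ _ _ G)) : F = G := by
  cases F; cases G
  cases h; cases h₁; cases h₂; rfl

/-- The category of pointed bigroupoids. -/
instance : Category.{u} PointedBigroupoid.{u} where
  Hom := Hom
  id B := ⟨Pseudofunctor.id _, rfl, rfl⟩
  comp F G := ⟨F.toPseudofunctor.comp G.toPseudofunctor,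
    (congrArg G.toPseudofunctor.obj F.obj_pt).trans G.obj_pt, by
      have h := G.map_id_pt
      rw [← F.obj_pt] at h
      exact (congrArg G.toPseudofunctor.map F.map_id_pt).trans h⟩
  id_comp F := by
    apply Hom.ext
    refine pseudofunctor_ext rfl (heq_of_eq ?_) (heq_of_eq ?_)
    · funext a
      apply Iso.ext
      change F.toPseudofunctor.map₂ (𝟙 _) ≫ (F.toPseudofunctor.mapId a).hom = _
      rw [F.toPseudofunctor.map₂_id, Category.id_comp]
    · funext a b c f g
      apply Iso.ext
      change F.toPseudofunctor.map₂ (𝟙 _) ≫ (F.toPseudofunctor.mapComp f g).hom = _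
      rw [F.toPseudofunctor.map₂_id, Category.id_comp]
  comp_id F := by
    apply Hom.ext
    refine pseudofunctor_ext rfl (heq_of_eq ?_) (heq_of_eq ?_)
    · funext a
      exact Iso.ext (Category.comp_id _)
    · funext a b c f g
      exact Iso.ext (Category.comp_id _)
  assoc F G H := by
    apply Hom.ext
    refine pseudofunctor_ext rfl (heq_of_eq ?_) (heq_of_eq ?_)
    · funext a
      exact Iso.ext ((congrArg (· ≫ (H.toPseudofunctor.mapId _).hom)
        (H.toPseudofunctor.map₂_comp _ _)).trans (Category.assoc _ _ _))
    · funext a b c f g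
      exact Iso.ext ((congrArg (· ≫ (H.toPseudofunctor.mapComp _ _).hom)
        (H.toPseudofunctor.map₂_comp _ _)).trans (Category.assoc _ _ _))

end PointedBigroupoid

/-! ### The 2-track groupoid underlying a pointed bigroupoid -/

section Underlying

variable (B : Type u) [Bicategory.{u, u} B]

/-- The groupoid `π₀ B`: its objects are those of `B`, its morphisms from `x` to `y` are the
components of the mapping groupoid `B(x, y)`. -/
structure PiZero : Type u where
  as : B

namespace PiZero

variable {B}

instance : Category.{u} (PiZero B) where
  Hom x y := GroupoidComp (x.as ⟶ y.as)
  id x := Quotient.mk _ (𝟙 x.as)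
  comp {x y z} := Quotient.map₂ (fun f g => f ≫ g) (by
    rintro f f' ⟨e⟩ g g' ⟨e'⟩
    exact ⟨whiskerRightIso e g ≪≫ whiskerLeftIso f' e'⟩)
  id_comp := by
    rintro x y ⟨f⟩
    exact Quotient.sound ⟨λ_ f⟩
  comp_id := by
    rintro x y ⟨f⟩
    exact Quotient.sound ⟨ρ_ f⟩
  assoc := by
    rintro x y z w ⟨f⟩ ⟨g⟩ ⟨h⟩
    exact Quotient.sound ⟨α_ f g h⟩

/-- The class of a 1-morphism. -/
def homMk {x y : B} (f : x ⟶ y) : (PiZero.mk x : PiZero B) ⟶ PiZero.mk y := Quotient.mk _ f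

theorem homMk_eq {x y : B} {f g : x ⟶ y} (h : IsIsomorphic f g) : homMk f = homMk g :=
  Quotient.sound h

theorem exact_of_homMk_eq {x y : B} {f g : x ⟶ y} (h : homMk f = homMk g) : IsIsomorphic f g :=
  Quotient.exact h

theorem homMk_surjective {x y : PiZero B} (f : x ⟶ y) : ∃ g : x.as ⟶ y.as, homMk g = f :=
  Quotient.exists_rep f

theorem homMk_comp {x y z : B} (f : x ⟶ y) (g : y ⟶ z) : homMk (f ≫ g) = homMk f ≫ homMk g := rfl

noncomputable instance [IsBigroupoid B] : Groupoid.{u} (PiZero B) :=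
  Groupoid.ofIsIso (by
    rintro x y ⟨f⟩
    obtain ⟨g, ⟨h⟩, ⟨h'⟩⟩ := IsBigroupoid.exists_inverse f
    exact ⟨homMk g, Quotient.sound ⟨h⟩, Quotient.sound ⟨h'⟩⟩)

end PiZero

variable {B}

/-- The coproduct over all objects `x` of the mapping groupoids `B(x, p)`. -/
abbrev MappingCoproduct (p : B) : Type u := Σ x : B, (x ⟶ p)

noncomputable instance [IsBigroupoid B] (p : B) : Groupoid.{u} (MappingCoproduct p) where
  inv
    | Sigma.SigmaHom.mk f => Sigma.SigmaHom.mk (inv f)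
  inv_comp := by
    rintro _ _ ⟨f⟩
    exact congrArg Sigma.SigmaHom.mk (IsIso.inv_hom_id f)
  comp_inv := by
    rintro _ _ ⟨f⟩
    exact congrArg Sigma.SigmaHom.mk (IsIso.hom_inv_id f)

/-- A 2-morphism between 1-morphisms to `p`, seen as a morphism of the coproduct. -/
def mappingHom {x p : B} {a b : x ⟶ p} (f : a ⟶ b) :
    (⟨x, a⟩ : MappingCoproduct p) ⟶ ⟨x, b⟩ := Sigma.SigmaHom.mk f

theorem mappingHom_comp {x p : B} {a b c : x ⟶ p} (f : a ⟶ b) (g : b ⟶ c) :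
    mappingHom (f ≫ g) = mappingHom f ≫ mappingHom g := rfl

theorem mappingHom_bijective {x p : B} (a b : x ⟶ p) :
    Function.Bijective (mappingHom : (a ⟶ b) → _) :=
  ⟨fun _ _ h => by injection h, fun ⟨f⟩ => ⟨f, rfl⟩⟩

/-- The inverse structural isomorphism: a 2-morphism `α` from the identity of `p` to itself is
whiskered with `a` and conjugated with the coherence 2-isomorphism `ρ : a ≫ 𝟙 p ≅ a` (in the
notation with composition of 1-morphisms written from right to left, this is the left identity
coherence 2-isomorphism of `𝟙 p • a`). -/
def psiInv {x p : B} (a : x ⟶ p) (α : 𝟙 p ⟶ 𝟙 p) : a ⟶ a :=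
  (ρ_ a).inv ≫ a ◁ α ≫ (ρ_ a).hom

theorem psiInv_comp {x p : B} (a : x ⟶ p) (α β : 𝟙 p ⟶ 𝟙 p) :
    psiInv a (α ≫ β) = psiInv a α ≫ psiInv a β := by
  simp [psiInv]

theorem whiskerLeft_injective {x y z : B} (f : x ⟶ y) (g : y ⟶ x) (e : g ≫ f ≅ 𝟙 y)
    {h k : y ⟶ z} {α β : h ⟶ k} (hαβ : f ◁ α = f ◁ β) : α = β := by
  have h1 : (g ≫ f) ◁ α = (g ≫ f) ◁ β := by simp [comp_whiskerLeft, hαβ]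
  have h2 : 𝟙 y ◁ α = 𝟙 y ◁ β := by
    rw [← cancel_epi (e.hom ▷ h), ← whisker_exchange, ← whisker_exchange, h1]
  simpa using h2

theorem whiskerLeft_surjective {x y z : B} (f : x ⟶ y) (g : y ⟶ x) (e : g ≫ f ≅ 𝟙 y)
    (e' : f ≫ g ≅ 𝟙 x) {h k : y ⟶ z} (γ : f ≫ h ⟶ f ≫ k) : ∃ α : h ⟶ k, f ◁ α = γ := by
  refine ⟨(λ_ h).inv ≫ e.inv ▷ h ≫ (α_ g f h).hom ≫ g ◁ γ ≫ (α_ g f k).inv ≫ e.hom ▷ k ≫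
    (λ_ k).hom, ?_⟩
  refine whiskerLeft_injective g f e' ?_
  generalize hα : (λ_ h).inv ≫ e.inv ▷ h ≫ (α_ g f h).hom ≫ g ◁ γ ≫ (α_ g f k).inv ≫
    e.hom ▷ k ≫ (λ_ k).hom = α
  have h1 : (g ≫ f) ◁ α ≫ e.hom ▷ k = e.hom ▷ h ≫ 𝟙 y ◁ α := whisker_exchange _ _
  have h2 : (g ≫ f) ◁ α = (α_ g f h).hom ≫ g ◁ γ ≫ (α_ g f k).inv := by
    rw [← cancel_mono (e.hom ▷ k), h1, ← hα]
    simp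
  simpa [comp_whiskerLeft] using h2

theorem psiInv_bijective [IsBigroupoid B] {x p : B} (a : x ⟶ p) :
    Function.Bijective (psiInv a) := by
  obtain ⟨b, ⟨e'⟩, ⟨e⟩⟩ := IsBigroupoid.exists_inverse a
  constructor
  · intro α β h
    refine whiskerLeft_injective a b e ?_
    simpa [psiInv] using h
  · intro γ
    obtain ⟨α, hα⟩ := whiskerLeft_surjective a b e e' ((ρ_ a).hom ≫ γ ≫ (ρ_ a).inv)
    exact ⟨α, by simp [psiInv, hα]⟩

theorem psiInv_natural {x p : B} {a b : x ⟶ p} (f : a ⟶ b) (α : 𝟙 p ⟶ 𝟙 p) :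
    psiInv a α ≫ f = f ≫ psiInv b α := by
  simp only [psiInv, Category.assoc, ← rightUnitor_naturality, whisker_exchange_assoc,
    rightUnitor_inv_naturality_assoc]

theorem psiInv_natural_assoc {x p : B} {a b c : x ⟶ p} (f : a ⟶ b) (α : 𝟙 p ⟶ 𝟙 p) (g : b ⟶ c) :
    psiInv a α ≫ f ≫ g = f ≫ psiInv b α ≫ g := by
  rw [← Category.assoc, psiInv_natural, Category.assoc]

/-- The map `psiInv` between the automorphism groups in the coproduct, as a bijection. -/
noncomputable def psiInvEquiv [IsBigroupoid B] {x p : B} (a : x ⟶ p) :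
    ((⟨p, 𝟙 p⟩ : MappingCoproduct p) ⟶ ⟨p, 𝟙 p⟩) ≃ ((⟨x, a⟩ : MappingCoproduct p) ⟶ ⟨x, a⟩) :=
  ((Equiv.ofBijective _ (mappingHom_bijective (𝟙 p) (𝟙 p))).symm.trans
    (Equiv.ofBijective _ (psiInv_bijective a))).trans
      (Equiv.ofBijective _ (mappingHom_bijective a a))

theorem psiInvEquiv_apply [IsBigroupoid B] {x p : B} (a : x ⟶ p) (α : 𝟙 p ⟶ 𝟙 p) :
    psiInvEquiv a (mappingHom α) = mappingHom (psiInv a α) := by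
  have h := Equiv.ofBijective_symm_apply_apply _ (mappingHom_bijective (𝟙 p) (𝟙 p)) α
  exact congrArg (fun β => mappingHom (psiInv a β)) h

/-- The structural isomorphism `ψ a : Aut(a) ≅ Aut(𝟙 p)`, inverse to `psiInv a`. -/
noncomputable def psiEquiv [IsBigroupoid B] {x p : B} (a : x ⟶ p) :
    ((⟨x, a⟩ : MappingCoproduct p) ⟶ ⟨x, a⟩) ≃*
      ((⟨p, 𝟙 p⟩ : MappingCoproduct p) ⟶ ⟨p, 𝟙 p⟩) :=
  (MulEquiv.mk' (psiInvEquiv a) (by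
    intro f g
    obtain ⟨α, rfl⟩ := (mappingHom_bijective _ _).2 f
    obtain ⟨β, rfl⟩ := (mappingHom_bijective _ _).2 g
    change psiInvEquiv a (mappingHom α ≫ mappingHom β) =
      psiInvEquiv a (mappingHom α) ≫ psiInvEquiv a (mappingHom β)
    rw [← mappingHom_comp, psiInvEquiv_apply, psiInvEquiv_apply, psiInvEquiv_apply, psiInv_comp,
      mappingHom_comp])).symm

theorem psiEquiv_psiInv [IsBigroupoid B] {x p : B} (a : x ⟶ p) (α : 𝟙 p ⟶ 𝟙 p) :
    psiEquiv a (mappingHom (psiInv a α)) = mappingHom α := by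
  rw [← psiInvEquiv_apply]
  exact (psiInvEquiv a).symm_apply_apply _

theorem psiEquiv_conj [IsBigroupoid B] {p : B} :
    ∀ {x y : MappingCoproduct p} (f : x ⟶ y) (α : y ⟶ y),
      psiEquiv x.2 (f ≫ α ≫ Groupoid.inv f) = psiEquiv y.2 α := by
  rintro _ _ ⟨f⟩ α
  rename_i x a b
  obtain ⟨α, rfl⟩ := (mappingHom_bijective _ _).2 α
  obtain ⟨β, rfl⟩ := (psiInv_bijective b).2 α
  have h : f ≫ psiInv b β ≫ inv f = psiInv a β := by
    rw [← psiInv_natural_assoc, IsIso.hom_inv_id, Category.comp_id]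
  refine Eq.trans ?_ (psiEquiv_psiInv b β).symm
  refine Eq.trans ?_ (psiEquiv_psiInv a β)
  exact congrArg (fun g => psiEquiv a (mappingHom g)) h

/-- The 2-track groupoid underlying a bigroupoid with a chosen object `p`. -/
noncomputable def underlyingTwoTrack (B : Type u) [Bicategory.{u, u} B] [IsBigroupoid B] (p : B) :
    TwoTrackGroupoid.{u} where
  G₁ := PiZero B
  pt₁ := ⟨p⟩
  G₂ := MappingCoproduct p
  pt₂ := ⟨p, 𝟙 p⟩
  strictlyAbelian := ⟨fun a => psiEquiv a.2, psiEquiv_conj⟩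
  q a := ⟨⟨a.1⟩, PiZero.homMk a.2⟩
  q_pt := rfl
  q_const := by
    rintro a b ⟨⟨⟨f⟩, _, _, _⟩⟩
    exact congrArg (Sigma.mk _) (PiZero.homMk_eq ⟨asIso f⟩)
  q_bijective := by
    constructor
    · rintro ⟨x, a⟩ ⟨y, b⟩ h
      obtain ⟨h1, h2⟩ := Sigma.mk.inj h
      obtain rfl : x = y := congrArg PiZero.as h1
      obtain ⟨e⟩ := PiZero.exact_of_homMk_eq (eq_of_heq h2)
      exact Quotient.sound ⟨(Sigma.incl (C := fun x : B => (x ⟶ p)) x).mapIso e⟩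
    · rintro ⟨x, f⟩
      obtain ⟨a, rfl⟩ := PiZero.homMk_surjective f
      exact ⟨Quotient.mk _ ⟨x.as, a⟩, rfl⟩

variable {C : Type u} [Bicategory.{u, u} C] (F : Pseudofunctor B C)

/-- The functor on the groupoids `π₀` induced by a homomorphism. -/
def piZeroFunctor : PiZero B ⥤ PiZero C where
  obj x := ⟨F.obj x.as⟩
  map {x y} := Quotient.map (fun f => F.map f) (by
    rintro f g ⟨e⟩
    exact ⟨F.map₂Iso e⟩)
  map_id x := Quotient.sound ⟨F.mapId x.as⟩
  map_comp := by
    rintro x y z ⟨f⟩ ⟨g⟩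
    exact Quotient.sound ⟨F.mapComp f g⟩

/-- The functor on coproducts of mapping groupoids induced by a homomorphism. -/
def mappingFunctor (p : B) : MappingCoproduct p ⥤ MappingCoproduct (F.obj p) where
  obj a := ⟨F.obj a.1, F.map a.2⟩
  map
    | Sigma.SigmaHom.mk f => Sigma.SigmaHom.mk (F.map₂ f)
  map_id := by
    rintro ⟨x, a⟩
    exact congrArg Sigma.SigmaHom.mk (F.map₂_id a)
  map_comp := by
    rintro _ _ _ ⟨f⟩ ⟨g⟩
    exact congrArg Sigma.SigmaHom.mk (F.map₂_comp f g)

theorem map_psiInv {x p : B} (a : x ⟶ p) (α : 𝟙 p ⟶ 𝟙 p) :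
    F.map₂ (psiInv a α) =
      psiInv (F.map a) ((F.mapId p).inv ≫ F.map₂ α ≫ (F.mapId p).hom) := by
  have h : F.map₂ (ρ_ a).inv = (ρ_ (F.map a)).inv ≫ F.map a ◁ (F.mapId p).inv ≫
      (F.mapComp a (𝟙 p)).inv := by
    rw [← cancel_epi (F.map₂ (ρ_ a).hom), ← F.map₂_comp]
    simp
  simp [psiInv, h]

theorem loop_comm [IsBigroupoid B] {p : B} (α β : 𝟙 p ⟶ 𝟙 p) : α ≫ β = β ≫ α := by
  obtain ⟨α, rfl⟩ := (psiInv_bijective (𝟙 p)).2 α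
  exact psiInv_natural β α

theorem mappingHom_eqToHom {x p : B} {a b : x ⟶ p} (h : a = b)
    (h' : (⟨x, a⟩ : MappingCoproduct p) = ⟨x, b⟩) : eqToHom h' = mappingHom (eqToHom h) := by
  subst h
  rfl

theorem mappingFunctor_psi [IsBigroupoid B] [IsBigroupoid C] {p : B}
    (hp : F.map (𝟙 p) = 𝟙 (F.obj p)) (a : MappingCoproduct p) (f : a ⟶ a)
    (h : (mappingFunctor F p).obj ⟨p, 𝟙 p⟩ = ⟨F.obj p, 𝟙 (F.obj p)⟩) :
    psiEquiv (F.map a.2) ((mappingFunctor F p).map f) =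
      eqToHom h.symm ≫ (mappingFunctor F p).map (psiEquiv a.2 f) ≫ eqToHom h := by
  obtain ⟨x, a⟩ := a
  obtain ⟨f, rfl⟩ := (mappingHom_bijective _ _).2 f
  obtain ⟨α, rfl⟩ := (psiInv_bijective a).2 f
  rw [psiEquiv_psiInv]
  have h1 : (mappingFunctor F p).map (mappingHom (psiInv a α)) =
      mappingHom (psiInv (F.map a) ((F.mapId p).inv ≫ F.map₂ α ≫ (F.mapId p).hom)) :=
    congrArg mappingHom (map_psiInv F a α)
  have h2 : psiEquiv (F.map a) ((mappingFunctor F p).map (mappingHom (psiInv a α))) =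
      mappingHom ((F.mapId p).inv ≫ F.map₂ α ≫ (F.mapId p).hom) := by
    rw [h1]
    exact psiEquiv_psiInv _ _
  refine h2.trans ?_
  have h3 : (F.mapId p).inv ≫ F.map₂ α ≫ (F.mapId p).hom =
      eqToHom hp.symm ≫ F.map₂ α ≫ eqToHom hp := by
    have h4 := loop_comm (eqToHom hp.symm ≫ F.map₂ α ≫ eqToHom hp)
      (eqToHom hp.symm ≫ (F.mapId p).hom)
    rw [Iso.inv_comp_eq, ← cancel_epi (eqToHom hp.symm)]
    simpa using h4
  refine (congrArg mappingHom h3).trans ?_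
  exact (congrArg₂ (fun u v => u ≫ (mappingFunctor F p).map (mappingHom α) ≫ v)
    (mappingHom_eqToHom hp.symm h.symm) (mappingHom_eqToHom hp h)).symm

/-- The morphism of 2-track groupoids induced by a homomorphism of bigroupoids which preserves the
identity of the chosen object. -/
noncomputable def underlyingTwoTrackMap [IsBigroupoid B] [IsBigroupoid C] (p : B)
    (hp : F.map (𝟙 p) = 𝟙 (F.obj p)) :
    underlyingTwoTrack B p ⟶ underlyingTwoTrack C (F.obj p) :=
  TwoTrackGroupoid.Hom.mk (piZeroFunctor F) (mappingFunctor F p) rfl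
    (congrArg (Sigma.mk (F.obj p)) hp) (fun _ f => mappingFunctor_psi F hp _ f _)
    (fun _ => Sigma.ext rfl (heq_of_eq (Category.comp_id _).symm))

end Underlying

namespace PointedBigroupoid

/-- The 2-track groupoid underlying a pointed bigroupoid. -/
noncomputable def underlying (B : PointedBigroupoid.{u}) : TwoTrackGroupoid.{u} :=
  underlyingTwoTrack B.carrier B.pt

/-- The morphism of 2-track groupoids underlying a morphism of pointed bigroupoids. -/
noncomputable def underlyingMap {B C : PointedBigroupoid.{u}} (F : B ⟶ C) :
    B.underlying ⟶ C.underlying :=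
  underlyingTwoTrackMap (Hom.toPseudofunctor F) B.pt (Hom.map_id_pt F) ≫
    eqToHom (congrArg (underlyingTwoTrack C.carrier) (Hom.obj_pt F))

end PointedBigroupoid

/-! ### The homotopy bigroupoid of a space -/

noncomputable section HomotopyBigroupoid

open scoped unitInterval

/-- The boundary of the square. -/
def squareBoundary : Set (I × I) := {z | z.1 = 0 ∨ z.1 = 1 ∨ z.2 = 0 ∨ z.2 = 1}

namespace PathTrack

variable {X : Type u} [TopologicalSpace X]

/-- Two homotopies between paths are equivalent if they are homotopic relative to the boundary of
the square. -/
instance setoid {x y : X} (p q : Path x y) : Setoid (Path.Homotopy p q) where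
  r F G := ContinuousMap.HomotopicRel F.toContinuousMap G.toContinuousMap squareBoundary
  iseqv := ⟨fun _ => ContinuousMap.HomotopicRel.refl _,
    fun h => ContinuousMap.HomotopicRel.symm h, fun h h' => ContinuousMap.HomotopicRel.trans h h'⟩

/-- A homotopy between paths, as a path in the space of paths. -/
def pathOf {x y : X} {p q : Path x y} (F : Path.Homotopy p q) : Path p q where
  toFun t := F.eval t
  continuous_toFun := Path.continuous_uncurry_iff.1 F.continuous
  source' := F.eval_zero
  target' := F.eval_one

theorem pathOf_apply {x y : X} {p q : Path x y} (F : Path.Homotopy p q) (t s : I) :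
    pathOf F t s = F (t, s) := rfl

theorem rel_iff {x y : X} {p q : Path x y} {F G : Path.Homotopy p q} :
    F ≈ G ↔ (pathOf F).Homotopic (pathOf G) := by
  constructor
  · rintro ⟨H⟩
    have hb : ∀ (u : I) (z : I × I), z ∈ squareBoundary → H (u, z) = F z := fun u z hz =>
      H.eq_fst u hz
    refine ⟨⟨⟨⟨fun z => ⟨⟨fun s => H (z.1, (z.2, s)), by fun_prop⟩, ?_, ?_⟩, ?_⟩, ?_, ?_⟩, ?_⟩⟩
    · exact (hb _ _ (Or.inr (Or.inr (Or.inl rfl)))).trans (F.source _)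
    · exact (hb _ _ (Or.inr (Or.inr (Or.inr rfl)))).trans (F.target _)
    · refine Path.continuous_uncurry_iff.1 ?_
      change Continuous fun w : (I × I) × I => H (w.1.1, (w.1.2, w.2))
      fun_prop
    · intro t
      ext s
      exact H.apply_zero (t, s)
    · intro t
      ext s
      exact H.apply_one (t, s)
    · intro u t ht
      ext s
      refine hb u (t, s) ?_
      rcases ht with ht | ht
      · exact Or.inl ht
      · exact Or.inr (Or.inl ht)
  · rintro ⟨K⟩
    refine ⟨⟨⟨⟨fun w => K (w.1, w.2.1) w.2.2, by fun_prop⟩, ?_, ?_⟩, ?_⟩⟩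
    · intro z
      exact congrArg (fun r : Path x y => r z.2) (K.apply_zero z.1)
    · intro z
      exact congrArg (fun r : Path x y => r z.2) (K.apply_one z.1)
    · rintro u ⟨t, s⟩ hz
      change K (u, t) s = F (t, s)
      rcases hz with h | h | h | h
      · obtain rfl : t = 0 := h
        exact congrArg (fun r : Path x y => r s) (K.eq_fst u (Or.inl rfl))
      · obtain rfl : t = 1 := h
        exact congrArg (fun r : Path x y => r s) (K.eq_fst u (Or.inr rfl))
      · obtain rfl : s = 0 := h
        exact ((K (u, t)).source).trans (F.source _).symm
      · obtain rfl : s = 1 := h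
        exact ((K (u, t)).target).trans (F.target _).symm

theorem pathOf_trans {x y : X} {p q r : Path x y} (F : Path.Homotopy p q)
    (G : Path.Homotopy q r) : pathOf (F.trans G) = (pathOf F).trans (pathOf G) := by
  ext t s
  rw [pathOf_apply, Path.Homotopy.trans_apply, Path.trans_apply]
  split_ifs <;> rfl

theorem pathOf_symm {x y : X} {p q : Path x y} (F : Path.Homotopy p q) :
    pathOf F.symm = (pathOf F).symm := by
  ext t s
  exact Path.Homotopy.symm_apply F (t, s)

theorem pathOf_hcomp {x y z : X} {p q : Path x y} {p' q' : Path y z} (F : Path.Homotopy p q)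
    (G : Path.Homotopy p' q') :
    pathOf (F.hcomp G) = ((pathOf F).prod (pathOf G)).map Path.continuous_trans := by
  ext t s
  rw [pathOf_apply, Path.Homotopy.hcomp_apply]
  change _ = ((pathOf F t).trans (pathOf G t)) s
  rw [Path.trans_apply]
  rfl

theorem square {Z : Type u} [TopologicalSpace Z] (Q : C(I × I, Z)) {a b c d : Z}
    {top : Path a b} {right : Path b d} {left : Path a c} {bot : Path c d}
    (h₁ : ∀ u, top u = Q (u, 0)) (h₂ : ∀ t, right t = Q (1, t)) (h₃ : ∀ t, left t = Q (0, t))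
    (h₄ : ∀ u, bot u = Q (u, 1)) : (top.trans right).Homotopic (left.trans bot) := by
  obtain rfl : Q (0, 0) = a := by rw [← h₁, top.source]
  obtain rfl : Q (1, 0) = b := by rw [← h₁, top.target]
  obtain rfl : Q (0, 1) = c := by rw [← h₃, left.target]
  obtain rfl : Q (1, 1) = d := by rw [← h₂, right.target]
  let e₁ : Path ((0, 0) : I × I) (1, 0) := Path.id.prod (Path.refl 0)
  let e₂ : Path ((1, 0) : I × I) (1, 1) := (Path.refl 1).prod Path.id
  let e₃ : Path ((0, 0) : I × I) (0, 1) := (Path.refl 0).prod Path.id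
  let e₄ : Path ((0, 1) : I × I) (1, 1) := Path.id.prod (Path.refl 1)
  have : ContractibleSpace I := (convex_Icc (0 : ℝ) 1).contractibleSpace ⟨0, by simp⟩
  have k : (e₁.trans e₂).Homotopic (e₃.trans e₄) := SimplyConnectedSpace.paths_homotopic _ _
  have k' := k.map Q
  rw [Path.map_trans, Path.map_trans] at k'
  convert k' using 2
  · ext u; exact h₁ u
  · ext u; exact h₂ u
  · ext u; exact h₃ u
  · ext u; exact h₄ u

/-- A 2-track between paths: an equivalence class of homotopies. -/
def TwoTrack {x y : X} (p q : Path x y) : Type u := Quotient (setoid p q)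

namespace TwoTrack

/-- The class of a homotopy. -/
def mk {x y : X} {p q : Path x y} (F : Path.Homotopy p q) : TwoTrack p q := Quotient.mk _ F

theorem sound {x y : X} {p q : Path x y} {F G : Path.Homotopy p q}
    (h : (pathOf F).Homotopic (pathOf G)) : mk F = mk G := Quotient.sound (rel_iff.2 h)

/-- Vertical composition of 2-tracks. -/
def comp {x y : X} {p q r : Path x y} : TwoTrack p q → TwoTrack q r → TwoTrack p r :=
  Quotient.map₂ Path.Homotopy.trans (fun F F' h G G' h' => by
    rw [rel_iff, pathOf_trans, pathOf_trans]
    exact (rel_iff.1 h).hcomp (rel_iff.1 h'))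

/-- The inverse 2-track. -/
def symm {x y : X} {p q : Path x y} : TwoTrack p q → TwoTrack q p :=
  Quotient.map Path.Homotopy.symm (fun F F' h => by
    rw [rel_iff, pathOf_symm, pathOf_symm]
    exact (rel_iff.1 h).symm₂)

/-- Horizontal composition of 2-tracks. -/
def hcomp {x y z : X} {p q : Path x y} {p' q' : Path y z} :
    TwoTrack p q → TwoTrack p' q' → TwoTrack (p.trans p') (q.trans q') :=
  Quotient.map₂ Path.Homotopy.hcomp (fun F F' h G G' h' => by
    rw [rel_iff, pathOf_hcomp, pathOf_hcomp]
    obtain ⟨K⟩ := rel_iff.1 h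
    obtain ⟨K'⟩ := rel_iff.1 h'
    exact Path.Homotopic.map ⟨Path.Homotopic.prodHomotopy K K'⟩ ⟨_, Path.continuous_trans⟩)

theorem id_comp {x y : X} {p q : Path x y} (F : TwoTrack p q) :
    comp (mk (Path.Homotopy.refl p)) F = F := by
  obtain ⟨F⟩ := F
  refine sound ?_
  rw [pathOf_trans]
  exact Path.Homotopic.refl_trans _

theorem comp_id {x y : X} {p q : Path x y} (F : TwoTrack p q) :
    comp F (mk (Path.Homotopy.refl q)) = F := by
  obtain ⟨F⟩ := F
  refine sound ?_
  rw [pathOf_trans]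
  exact Path.Homotopic.trans_refl _

theorem assoc {x y : X} {p q r s : Path x y} (F : TwoTrack p q) (G : TwoTrack q r)
    (H : TwoTrack r s) : comp (comp F G) H = comp F (comp G H) := by
  obtain ⟨F⟩ := F
  obtain ⟨G⟩ := G
  obtain ⟨H⟩ := H
  refine sound ?_
  rw [pathOf_trans, pathOf_trans, pathOf_trans, pathOf_trans]
  exact Path.Homotopic.trans_assoc _ _ _

theorem symm_comp {x y : X} {p q : Path x y} (F : TwoTrack p q) :
    comp (symm F) F = mk (Path.Homotopy.refl q) := by
  obtain ⟨F⟩ := F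
  refine sound ?_
  rw [pathOf_trans, pathOf_symm]
  exact Path.Homotopic.symm_trans _

theorem comp_symm {x y : X} {p q : Path x y} (F : TwoTrack p q) :
    comp F (symm F) = mk (Path.Homotopy.refl p) := by
  obtain ⟨F⟩ := F
  refine sound ?_
  rw [pathOf_trans, pathOf_symm]
  exact Path.Homotopic.trans_symm _

theorem symm_symm {x y : X} {p q : Path x y} (F : TwoTrack p q) : symm (symm F) = F := by
  obtain ⟨F⟩ := F
  exact congrArg mk (Path.Homotopy.symm_symm F)

theorem hcomp_refl {x y z : X} (p : Path x y) (q : Path y z) :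
    hcomp (mk (Path.Homotopy.refl p)) (mk (Path.Homotopy.refl q)) =
      mk (Path.Homotopy.refl (p.trans q)) := by
  refine sound ?_
  rw [pathOf_hcomp]
  exact Path.Homotopic.refl _

theorem hcomp_comp {x y z : X} {p q r : Path x y} {p' q' r' : Path y z} (F : TwoTrack p q)
    (G : TwoTrack q r) (F' : TwoTrack p' q') (G' : TwoTrack q' r') :
    hcomp (comp F G) (comp F' G') = comp (hcomp F F') (hcomp G G') := by
  obtain ⟨F⟩ := F
  obtain ⟨G⟩ := G
  obtain ⟨F'⟩ := F'
  obtain ⟨G'⟩ := G'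
  refine sound ?_
  rw [pathOf_trans, pathOf_hcomp, pathOf_hcomp, pathOf_hcomp, pathOf_trans, pathOf_trans,
    ← Path.trans_prod_eq_prod_trans, Path.map_trans]

/-- The left unit 2-track. -/
def leftUnitor {x y : X} (p : Path x y) : TwoTrack ((Path.refl x).trans p) p :=
  mk (Path.Homotopy.reflTrans p)

/-- The right unit 2-track. -/
def rightUnitor {x y : X} (p : Path x y) : TwoTrack (p.trans (Path.refl y)) p :=
  mk (Path.Homotopy.transRefl p)

/-- The associativity 2-track. -/
def associator {x y z w : X} (p : Path x y) (q : Path y z) (r : Path z w) :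
    TwoTrack ((p.trans q).trans r) (p.trans (q.trans r)) :=
  mk (Path.Homotopy.transAssoc p q r)

end TwoTrack

/-- Convex combination in the unit interval. -/
def mix (t a b : I) : I :=
  ⟨(σ t : ℝ) * (a : ℝ) + (t : ℝ) * (b : ℝ),
    convex_Icc (0 : ℝ) 1 a.2 b.2 (σ t).2.1 t.2.1 (by simp)⟩

/-- The parameter of the right unit homotopy. -/
def rightParam (z : I × I) : I :=
  mix (σ z.1) z.2
    ⟨Path.Homotopy.transReflReparamAux z.2, Path.Homotopy.transReflReparamAux_mem_I z.2⟩

theorem continuous_rightParam : Continuous rightParam := by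
  unfold rightParam mix
  fun_prop

theorem transRefl_apply {x y : X} (p : Path x y) (z : I × I) :
    Path.Homotopy.transRefl p z = p (rightParam z) := rfl

theorem reflTrans_apply {x y : X} (p : Path x y) (z : I × I) :
    Path.Homotopy.reflTrans p z = p (σ (rightParam (z.1, σ z.2))) := rfl

/-- The parameter of the associativity homotopy. -/
def assocParam (z : I × I) : I :=
  mix (σ z.1) z.2
    ⟨Path.Homotopy.transAssocReparamAux z.2, Path.Homotopy.transAssocReparamAux_mem_I z.2⟩

theorem continuous_assocParam : Continuous assocParam := by
  unfold assocParam mix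
  fun_prop

theorem transAssoc_apply {x y z w : X} (p : Path x y) (q : Path y z) (r : Path z w) (v : I × I) :
    Path.Homotopy.transAssoc p q r v = (p.trans (q.trans r)) (assocParam v) := rfl

/-- Homotopies depending on a parameter give commuting squares of 2-tracks. -/
theorem natural {x y : X} {p q p' q' : Path x y} (F : Path.Homotopy p q)
    (G : Path.Homotopy p' q') (K : Path.Homotopy p p') (L : Path.Homotopy q q')
    (R : (I × I) × I → X) (hR : Continuous R) (h₁ : ∀ u s, F (u, s) = R ((u, 0), s))
    (h₂ : ∀ t s, L (t, s) = R ((1, t), s)) (h₃ : ∀ t s, K (t, s) = R ((0, t), s))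
    (h₄ : ∀ u s, G (u, s) = R ((u, 1), s)) (h₅ : ∀ z, R (z, 0) = x) (h₆ : ∀ z, R (z, 1) = y) :
    TwoTrack.comp (TwoTrack.mk F) (TwoTrack.mk L) =
      TwoTrack.comp (TwoTrack.mk K) (TwoTrack.mk G) := by
  refine TwoTrack.sound ?_
  rw [pathOf_trans, pathOf_trans]
  let Q : C(I × I, Path x y) :=
    ⟨fun z => ⟨⟨fun s => R (z, s), by fun_prop⟩, h₅ z, h₆ z⟩, Path.continuous_uncurry_iff.1 hR⟩
  refine square Q ?_ ?_ ?_ ?_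
  · intro u; ext s; exact h₁ u s
  · intro u; ext s; exact h₂ u s
  · intro u; ext s; exact h₃ u s
  · intro u; ext s; exact h₄ u s

theorem rightParam_zero (t : I) : rightParam (t, 0) = 0 := by
  ext
  simp [rightParam, mix, Path.Homotopy.transReflReparamAux_zero]

theorem rightParam_one (t : I) : rightParam (t, 1) = 1 := by
  ext
  simp [rightParam, mix, Path.Homotopy.transReflReparamAux_one]

theorem assocParam_zero (t : I) : assocParam (t, 0) = 0 := by
  ext
  simp [assocParam, mix, Path.Homotopy.transAssocReparamAux_zero]

theorem assocParam_one (t : I) : assocParam (t, 1) = 1 := by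
  ext
  simp [assocParam, mix, Path.Homotopy.transAssocReparamAux_one]

theorem hcomp_eval {x y z : X} {p q : Path x y} {p' q' : Path y z} (F : Path.Homotopy p q)
    (G : Path.Homotopy p' q') (u s : I) :
    (F.hcomp G) (u, s) = ((F.eval u).trans (G.eval u)) s :=
  congrArg (fun r => r u s) (pathOf_hcomp F G)

namespace TwoTrack

theorem rightUnitor_natural {x y : X} {p q : Path x y} (F : TwoTrack p q) :
    comp (hcomp F (mk (Path.Homotopy.refl (Path.refl y)))) (rightUnitor q) =
      comp (rightUnitor p) F := by
  obtain ⟨F⟩ := F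
  refine natural (F.hcomp (Path.Homotopy.refl (Path.refl y))) F (Path.Homotopy.transRefl p)
    (Path.Homotopy.transRefl q) (fun w => F (w.1.1, rightParam (w.1.2, w.2)))
    (F.continuous.comp (by have := continuous_rightParam; fun_prop)) ?_ ?_ ?_ ?_ ?_ ?_
  · intro u s
    exact (hcomp_eval _ _ u s).trans
      ((Path.Homotopy.transRefl (F.eval u)).apply_zero s).symm
  · intro t s
    rw [transRefl_apply]
    exact (F.apply_one _).symm
  · intro t s
    rw [transRefl_apply]
    exact (F.apply_zero _).symm
  · intro u s
    exact ((Path.Homotopy.transRefl (F.eval u)).apply_one s).symm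
  · intro z
    simp [rightParam_zero]
  · intro z
    simp [rightParam_one]

theorem leftUnitor_natural {x y : X} {p q : Path x y} (F : TwoTrack p q) :
    comp (hcomp (mk (Path.Homotopy.refl (Path.refl x))) F) (leftUnitor q) =
      comp (leftUnitor p) F := by
  obtain ⟨F⟩ := F
  refine natural ((Path.Homotopy.refl (Path.refl x)).hcomp F) F (Path.Homotopy.reflTrans p)
    (Path.Homotopy.reflTrans q) (fun w => F (w.1.1, σ (rightParam (w.1.2, σ w.2))))
    (F.continuous.comp (by have := continuous_rightParam; fun_prop)) ?_ ?_ ?_ ?_ ?_ ?_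
  · intro u s
    exact (hcomp_eval _ _ u s).trans
      ((Path.Homotopy.reflTrans (F.eval u)).apply_zero s).symm
  · intro t s
    rw [reflTrans_apply]
    exact (F.apply_one _).symm
  · intro t s
    rw [reflTrans_apply]
    exact (F.apply_zero _).symm
  · intro u s
    exact ((Path.Homotopy.reflTrans (F.eval u)).apply_one s).symm
  · intro z
    simp [rightParam_one]
  · intro z
    simp [rightParam_zero]

theorem associator_natural {x y z w : X} {p p' : Path x y} {q q' : Path y z} {r r' : Path z w}
    (F : TwoTrack p p') (G : TwoTrack q q') (H : TwoTrack r r') :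
    comp (hcomp (hcomp F G) H) (associator p' q' r') =
      comp (associator p q r) (hcomp F (hcomp G H)) := by
  obtain ⟨F⟩ := F
  obtain ⟨G⟩ := G
  obtain ⟨H⟩ := H
  refine natural ((F.hcomp G).hcomp H) (F.hcomp (G.hcomp H)) (Path.Homotopy.transAssoc p q r)
    (Path.Homotopy.transAssoc p' q' r')
    (fun v => (F.hcomp (G.hcomp H)) (v.1.1, assocParam (v.1.2, v.2)))
    (Continuous.comp (ContinuousMap.continuous _)
      (by have := continuous_assocParam; fun_prop)) ?_ ?_ ?_ ?_ ?_ ?_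
  · intro u s
    rw [hcomp_eval, hcomp_eval]
    have h := (Path.Homotopy.transAssoc (F.eval u) (G.eval u) (H.eval u)).apply_zero s
    have h' : (F.hcomp G).eval u = (F.eval u).trans (G.eval u) := by
      ext s
      exact hcomp_eval F G u s
    have h'' : (G.hcomp H).eval u = (G.eval u).trans (H.eval u) := by
      ext s
      exact hcomp_eval G H u s
    rw [h', h'']
    exact h.symm
  · intro t s
    rw [transAssoc_apply]
    exact (ContinuousMap.HomotopyWith.apply_one _ _).symm
  · intro t s
    rw [transAssoc_apply]
    exact (ContinuousMap.HomotopyWith.apply_zero _ _).symm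
  · intro u s
    rw [hcomp_eval, hcomp_eval]
    have h'' : (G.hcomp H).eval u = (G.eval u).trans (H.eval u) := by
      ext s
      exact hcomp_eval G H u s
    rw [h'']
    exact ((Path.Homotopy.transAssoc (F.eval u) (G.eval u) (H.eval u)).apply_one s).symm
  · intro z
    simp [assocParam_zero]
  · intro z
    simp [assocParam_one]

end TwoTrack

/-- The homotopy `F` factors as the map `m` after the homotopy `F'` of real paths. -/
def Factors (m : C(ℝ, X)) {x y : X} {p q : Path x y} {a b : ℝ} {p' q' : Path a b}
    (F : Path.Homotopy p q) (F' : Path.Homotopy p' q') : Prop := ∀ z, F z = m (F' z)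

/-- The path `p` factors as the map `m` after the real path `p'`. -/
def PathFactors (m : C(ℝ, X)) {x y : X} {a b : ℝ} (p : Path x y) (p' : Path a b) : Prop :=
  ∀ t, p t = m (p' t)

theorem PathFactors.trans {m : C(ℝ, X)} {x y z : X} {a b c : ℝ} {p : Path x y} {p' : Path a b}
    {q : Path y z} {q' : Path b c} (h : PathFactors m p p') (h' : PathFactors m q q') :
    PathFactors m (p.trans q) (p'.trans q') := by
  intro t
  rw [Path.trans_apply, Path.trans_apply]
  split_ifs
  · exact h _
  · exact h' _

theorem Factors.refl {m : C(ℝ, X)} {x y : X} {a b : ℝ} {p : Path x y} {p' : Path a b}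
    (h : PathFactors m p p') : Factors m (Path.Homotopy.refl p) (Path.Homotopy.refl p') :=
  fun z => h z.2

theorem Factors.reflTrans {m : C(ℝ, X)} {x y : X} {a b : ℝ} {p : Path x y} {p' : Path a b}
    (h : PathFactors m p p') :
    Factors m (Path.Homotopy.reflTrans p) (Path.Homotopy.reflTrans p') := by
  intro z
  rw [reflTrans_apply, reflTrans_apply]
  exact h _

theorem Factors.transRefl {m : C(ℝ, X)} {x y : X} {a b : ℝ} {p : Path x y} {p' : Path a b}
    (h : PathFactors m p p') :
    Factors m (Path.Homotopy.transRefl p) (Path.Homotopy.transRefl p') := by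
  intro z
  rw [transRefl_apply, transRefl_apply]
  exact h _

theorem Factors.transAssoc {m : C(ℝ, X)} {x y z w : X} {a b c d : ℝ} {p : Path x y}
    {p' : Path a b} {q : Path y z} {q' : Path b c} {r : Path z w} {r' : Path c d}
    (h : PathFactors m p p') (h' : PathFactors m q q') (h'' : PathFactors m r r') :
    Factors m (Path.Homotopy.transAssoc p q r) (Path.Homotopy.transAssoc p' q' r') := by
  intro v
  rw [transAssoc_apply, transAssoc_apply]
  exact h.trans (h'.trans h'') _

theorem Factors.trans {m : C(ℝ, X)} {x y : X} {a b : ℝ} {p q r : Path x y} {p' q' r' : Path a b}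
    {F : Path.Homotopy p q} {F' : Path.Homotopy p' q'} {G : Path.Homotopy q r}
    {G' : Path.Homotopy q' r'} (h : Factors m F F') (h' : Factors m G G') :
    Factors m (F.trans G) (F'.trans G') := by
  intro z
  rw [Path.Homotopy.trans_apply, Path.Homotopy.trans_apply]
  split_ifs
  · exact h _
  · exact h' _

theorem Factors.hcomp {m : C(ℝ, X)} {x y z : X} {a b c : ℝ} {p q : Path x y} {p' q' : Path a b}
    {r s : Path y z} {r' s' : Path b c}
    {F : Path.Homotopy p q} {F' : Path.Homotopy p' q'} {G : Path.Homotopy r s}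
    {G' : Path.Homotopy r' s'} (h : Factors m F F') (h' : Factors m G G') :
    Factors m (F.hcomp G) (F'.hcomp G') := by
  intro z
  rw [Path.Homotopy.hcomp_apply, Path.Homotopy.hcomp_apply]
  split_ifs
  · exact h _
  · exact h' _

/-- Two homotopies between the same paths which factor through homotopies between the same real
paths define the same 2-track. -/
theorem Factors.mk_eq {m : C(ℝ, X)} {x y : X} {a b : ℝ} {p q : Path x y} {p' q' : Path a b}
    {F G : Path.Homotopy p q} {F' G' : Path.Homotopy p' q'} (h : Factors m F F')
    (h' : Factors m G G') : TwoTrack.mk F = TwoTrack.mk G := by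
  refine Quotient.sound ⟨⟨⟨⟨fun w => m ((1 - (w.1 : ℝ)) * F' w.2 + (w.1 : ℝ) * G' w.2), ?_⟩,
    ?_, ?_⟩, ?_⟩⟩
  · have := F'.continuous
    have := G'.continuous
    fun_prop
  · intro z
    simpa using (h z).symm
  · intro z
    simpa using (h' z).symm
  · intro u z hz
    change m ((1 - (u : ℝ)) * F' z + (u : ℝ) * G' z) = F z
    have e : F' z = G' z := by
      obtain ⟨t, s⟩ := z
      rcases hz with h | h | h | h
      · obtain rfl : t = 0 := h
        exact (F'.apply_zero s).trans (G'.apply_zero s).symm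
      · obtain rfl : t = 1 := h
        exact (F'.apply_one s).trans (G'.apply_one s).symm
      · obtain rfl : s = 0 := h
        exact (F'.source t).trans (G'.source t).symm
      · obtain rfl : s = 1 := h
        exact (F'.target t).trans (G'.target t).symm
    rw [h z, ← e]
    congr 1
    ring

/-- The affine path of length one. -/
def unitPath (a b : ℝ) (h : b = a + 1) : Path a b where
  toFun t := a + t
  source' := by simp
  target' := by simp [h]

/-- Gluing maps on the real line. -/
theorem exists_glue (m n : C(ℝ, X)) (c : ℝ) (h : m c = n c) :
    ∃ k : C(ℝ, X), (∀ t ≤ c, k t = m t) ∧ ∀ t, c ≤ t → k t = n t := by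
  refine ⟨⟨fun t => if t ≤ c then m t else n t, ?_⟩, ?_, ?_⟩
  · refine Continuous.if_le (by fun_prop) (by fun_prop) (by fun_prop) (by fun_prop) ?_
    rintro t rfl
    exact h
  · intro t ht
    exact if_pos ht
  · intro t ht
    rcases eq_or_lt_of_le ht with rfl | ht
    · exact (if_pos le_rfl).trans h
    · exact if_neg (not_le.2 ht)

theorem exists_factors {x₀ x₁ x₂ x₃ x₄ : X} (p : Path x₀ x₁) (q : Path x₁ x₂) (r : Path x₂ x₃)
    (s : Path x₃ x₄) : ∃ m : C(ℝ, X), PathFactors m p (unitPath 0 1 (by norm_num)) ∧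
      PathFactors m q (unitPath 1 2 (by norm_num)) ∧
      PathFactors m r (unitPath 2 3 (by norm_num)) ∧
      PathFactors m s (unitPath 3 4 (by norm_num)) := by
  obtain ⟨m₁, h₁, h₁'⟩ := exists_glue (r.extend.comp ⟨fun t : ℝ => t - 2, by fun_prop⟩)
    (s.extend.comp ⟨fun t : ℝ => t - 3, by fun_prop⟩) 3 (by norm_num)
  obtain ⟨m₂, h₂, h₂'⟩ := exists_glue (q.extend.comp ⟨fun t : ℝ => t - 1, by fun_prop⟩) m₁ 2
    (by rw [h₁ _ (by norm_num)]; norm_num)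
  obtain ⟨m₃, h₃, h₃'⟩ := exists_glue p.extend m₂ 1
    (by rw [h₂ _ (by norm_num)]; norm_num)
  refine ⟨m₃, ?_, ?_, ?_, ?_⟩
  · intro t
    have := t.2.1
    have := t.2.2
    change p t = m₃ (0 + t)
    rw [h₃ _ (by linarith)]
    simp
  · intro t
    have := t.2.1
    have := t.2.2
    change q t = m₃ (1 + t)
    rw [h₃' _ (by linarith), h₂ _ (by linarith)]
    simp
  · intro t
    have := t.2.1
    have := t.2.2
    change r t = m₃ (2 + t)
    rw [h₃' _ (by linarith), h₂' _ (by linarith), h₁ _ (by linarith)]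
    simp
  · intro t
    have := t.2.1
    have := t.2.2
    change s t = m₃ (3 + t)
    rw [h₃' _ (by linarith), h₂' _ (by linarith), h₁' _ (by linarith)]
    simp

theorem pathFactors_refl {m : C(ℝ, X)} {x y : X} {a b : ℝ} {p : Path x y} {p' : Path a b}
    (h : PathFactors m p p') : PathFactors m (Path.refl y) (Path.refl b) := by
  intro t
  have := h 1
  rw [p.target, p'.target] at this
  exact this

namespace TwoTrack

theorem eq_of_square {x y : X} {p q r s : Path x y} {A : TwoTrack p q} {B : TwoTrack q s}
    {C : TwoTrack p r} {D : TwoTrack r s} (h : comp A B = comp C D) :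
    A = comp C (comp D (symm B)) := by
  rw [← assoc, ← h, assoc, comp_symm, comp_id]

theorem eq_of_square' {x y : X} {p q r s : Path x y} {A : TwoTrack p q} {B : TwoTrack q s}
    {C : TwoTrack p r} {D : TwoTrack r s} (h : comp A B = comp C D) :
    D = comp (symm C) (comp A B) := by
  rw [h, ← assoc, symm_comp, id_comp]

theorem pentagon {x₀ x₁ x₂ x₃ x₄ : X} (p : Path x₀ x₁) (q : Path x₁ x₂) (r : Path x₂ x₃)
    (s : Path x₃ x₄) :
    comp (hcomp (associator p q r) (mk (Path.Homotopy.refl s)))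
      (comp (associator p (q.trans r) s)
        (hcomp (mk (Path.Homotopy.refl p)) (associator q r s))) =
    comp (associator (p.trans q) r s) (associator p q (r.trans s)) := by
  obtain ⟨m, hp, hq, hr, hs⟩ := exists_factors p q r s
  exact Factors.mk_eq
    (((Factors.transAssoc hp hq hr).hcomp (Factors.refl hs)).trans
      ((Factors.transAssoc hp (hq.trans hr) hs).trans
        ((Factors.refl hp).hcomp (Factors.transAssoc hq hr hs))))
    ((Factors.transAssoc (hp.trans hq) hr hs).trans (Factors.transAssoc hp hq (hr.trans hs)))

theorem triangle {x₀ x₁ x₂ : X} (p : Path x₀ x₁) (q : Path x₁ x₂) :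
    comp (associator p (Path.refl x₁) q) (hcomp (mk (Path.Homotopy.refl p)) (leftUnitor q)) =
      hcomp (rightUnitor p) (mk (Path.Homotopy.refl q)) := by
  obtain ⟨m, hp, hq, -, -⟩ := exists_factors p q (Path.refl x₂) (Path.refl x₂)
  exact Factors.mk_eq
    ((Factors.transAssoc hp (pathFactors_refl hp) hq).trans
      ((Factors.refl hp).hcomp (Factors.reflTrans hq)))
    ((Factors.transRefl hp).hcomp (Factors.refl hq))

end TwoTrack

end PathTrack

/-- The objects of the homotopy bigroupoid of a space: its points. -/
structure HomotopyBigroupoid (X : Type u) : Type u where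
  as : X

namespace HomotopyBigroupoid

open PathTrack

variable {X : Type u} [TopologicalSpace X]

instance : CategoryStruct.{u} (HomotopyBigroupoid X) where
  Hom x y := Path x.as y.as
  id x := Path.refl x.as
  comp p q := p.trans q

instance (x y : HomotopyBigroupoid X) : Groupoid.{u} (x ⟶ y) where
  Hom p q := TwoTrack (X := X) p q
  id p := TwoTrack.mk (Path.Homotopy.refl p)
  comp F G := TwoTrack.comp F G
  id_comp := TwoTrack.id_comp
  comp_id := TwoTrack.comp_id
  assoc := TwoTrack.assoc
  inv F := TwoTrack.symm F
  inv_comp := TwoTrack.symm_comp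
  comp_inv := TwoTrack.comp_symm

/-- A 2-track as a 2-isomorphism. -/
def isoMk {x y : HomotopyBigroupoid X} {p q : x ⟶ y} (F : TwoTrack (X := X) p q) : p ≅ q where
  hom := F
  inv := TwoTrack.symm F
  hom_inv_id := TwoTrack.comp_symm F
  inv_hom_id := TwoTrack.symm_comp F

instance : Bicategory.{u, u} (HomotopyBigroupoid X) where
  homCategory x y := inferInstance
  whiskerLeft p _ _ F := TwoTrack.hcomp (TwoTrack.mk (Path.Homotopy.refl p)) F
  whiskerRight F p := TwoTrack.hcomp F (TwoTrack.mk (Path.Homotopy.refl p))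
  associator p q r := isoMk (TwoTrack.associator p q r)
  leftUnitor p := isoMk (TwoTrack.leftUnitor p)
  rightUnitor p := isoMk (TwoTrack.rightUnitor p)
  whiskerLeft_id _ _ := TwoTrack.hcomp_refl _ _
  whiskerLeft_comp p _ _ _ F G := by
    change TwoTrack.hcomp _ (TwoTrack.comp F G) = TwoTrack.comp _ _
    rw [← TwoTrack.hcomp_comp, TwoTrack.comp_id]
  id_whiskerLeft F := TwoTrack.eq_of_square (TwoTrack.leftUnitor_natural F)
  comp_whiskerLeft p q _ _ F := by
    refine (congrArg (TwoTrack.hcomp · F) (TwoTrack.hcomp_refl p q)).symm.trans ?_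
    exact TwoTrack.eq_of_square (TwoTrack.associator_natural _ _ F)
  id_whiskerRight _ _ := TwoTrack.hcomp_refl _ _
  comp_whiskerRight F G p := by
    change TwoTrack.hcomp (TwoTrack.comp F G) _ = TwoTrack.comp _ _
    rw [← TwoTrack.hcomp_comp, TwoTrack.comp_id]
  whiskerRight_id F := TwoTrack.eq_of_square (TwoTrack.rightUnitor_natural F)
  whiskerRight_comp F p q := by
    refine (congrArg (TwoTrack.hcomp F) (TwoTrack.hcomp_refl p q)).symm.trans ?_
    exact TwoTrack.eq_of_square' (TwoTrack.associator_natural F _ _)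
  whisker_assoc p _ _ F q := TwoTrack.eq_of_square (TwoTrack.associator_natural _ F _)
  whisker_exchange F G := by
    change TwoTrack.comp (TwoTrack.hcomp _ _) (TwoTrack.hcomp _ _) =
      TwoTrack.comp (TwoTrack.hcomp _ _) (TwoTrack.hcomp _ _)
    rw [← TwoTrack.hcomp_comp, ← TwoTrack.hcomp_comp, TwoTrack.id_comp, TwoTrack.comp_id,
      TwoTrack.id_comp, TwoTrack.comp_id]
  pentagon p q r s := TwoTrack.pentagon p q r s
  triangle p q := TwoTrack.triangle p q

instance : IsBigroupoid (HomotopyBigroupoid X) where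
  isGroupoid _ _ := inferInstance
  exists_inverse p := ⟨Path.symm p,
    ⟨(isoMk (TwoTrack.mk (Path.Homotopy.reflTransSymm p))).symm⟩,
    ⟨(isoMk (TwoTrack.mk (Path.Homotopy.reflSymmTrans p))).symm⟩⟩

variable {Y : Type u} [TopologicalSpace Y]

theorem heq_mk {x y : X} {p q p' q' : Path x y} (F : Path.Homotopy p q)
    (F' : Path.Homotopy p' q') (h : ∀ z, F z = F' z) :
    HEq (TwoTrack.mk F) (TwoTrack.mk F') := by
  obtain rfl : p = p' := by
    ext s
    exact (F.apply_zero s).symm.trans ((h _).trans (F'.apply_zero s))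
  obtain rfl : q = q' := by
    ext s
    exact (F.apply_one s).symm.trans ((h _).trans (F'.apply_one s))
  obtain rfl : F = F' := by
    ext z
    exact h z
  rfl

/-- The map on 2-tracks induced by a continuous map. -/
def mapTwoTrack (f : C(X, Y)) {x y : X} {p q : Path x y} :
    TwoTrack p q → TwoTrack (p.map f.continuous) (q.map f.continuous) :=
  Quotient.map (fun F => F.map f) (fun _ _ h => h.comp_continuousMap f)

theorem mapTwoTrack_comp (f : C(X, Y)) {x y : X} {p q r : Path x y} (F : TwoTrack p q)
    (G : TwoTrack q r) :
    mapTwoTrack f (F.comp G) = (mapTwoTrack f F).comp (mapTwoTrack f G) := by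
  obtain ⟨F⟩ := F
  obtain ⟨G⟩ := G
  refine eq_of_heq (heq_mk _ _ fun z => ?_)
  change f (F.trans G z) = _
  rw [Path.Homotopy.trans_apply, Path.Homotopy.trans_apply]
  split_ifs <;> rfl

theorem mapTwoTrack_hcomp (f : C(X, Y)) {x y z : X} {p q : Path x y} {p' q' : Path y z}
    (F : TwoTrack p q) (G : TwoTrack p' q') :
    HEq (mapTwoTrack f (F.hcomp G)) ((mapTwoTrack f F).hcomp (mapTwoTrack f G)) := by
  obtain ⟨F⟩ := F
  obtain ⟨G⟩ := G
  refine heq_mk _ _ fun z => ?_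
  change f (F.hcomp G z) = _
  rw [Path.Homotopy.hcomp_apply, Path.Homotopy.hcomp_apply]
  split_ifs <;> rfl

theorem eq_eqToHom_comp {C : Type u} [Category.{u} C] {a b c : C} (h : a = b) {f : a ⟶ c}
    {g : b ⟶ c} (e : HEq f g) : f = eqToHom h ≫ g := by
  subst h
  simpa using e

theorem mapTwoTrack_leftUnitor (f : C(X, Y)) {x y : X} (p : Path x y) :
    HEq (mapTwoTrack f (TwoTrack.leftUnitor p))
      (TwoTrack.leftUnitor (p.map f.continuous)) := by
  refine heq_mk _ _ fun z => ?_
  change f (Path.Homotopy.reflTrans p z) = _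
  rw [reflTrans_apply, reflTrans_apply]
  rfl

theorem mapTwoTrack_rightUnitor (f : C(X, Y)) {x y : X} (p : Path x y) :
    HEq (mapTwoTrack f (TwoTrack.rightUnitor p))
      (TwoTrack.rightUnitor (p.map f.continuous)) := by
  refine heq_mk _ _ fun z => ?_
  change f (Path.Homotopy.transRefl p z) = _
  rw [transRefl_apply, transRefl_apply]
  rfl

theorem mapTwoTrack_associator (f : C(X, Y)) {x y z w : X} (p : Path x y) (q : Path y z)
    (r : Path z w) :
    HEq (mapTwoTrack f (TwoTrack.associator p q r))
      (TwoTrack.associator (p.map f.continuous) (q.map f.continuous) (r.map f.continuous)) := by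
  have h : (p.trans (q.trans r)).map f.continuous =
      (p.map f.continuous).trans ((q.map f.continuous).trans (r.map f.continuous)) := by
    rw [Path.map_trans, Path.map_trans]
  refine heq_mk _ _ fun v => ?_
  change f (Path.Homotopy.transAssoc p q r v) = _
  rw [transAssoc_apply, transAssoc_apply]
  exact congrArg (fun k => k (assocParam v)) h

/-- The maps on points, paths and 2-tracks induced by a continuous map. -/
def inducedPrelax (f : C(X, Y)) : PrelaxFunctor (HomotopyBigroupoid X) (HomotopyBigroupoid Y) where
  obj x := ⟨f x.as⟩
  map p := Path.map p f.continuous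
  map₂ F := mapTwoTrack f F
  map₂_id _ := eq_of_heq (heq_mk _ _ fun _ => rfl)
  map₂_comp F G := mapTwoTrack_comp f F G

theorem prelax_ext {B C : Type u} [Bicategory.{u, u} B] [Bicategory.{u, u} C]
    {F G : PrelaxFunctor B C} (h : F.toPrefunctor = G.toPrefunctor)
    (h' : HEq (@PrelaxFunctorStruct.map₂ _ _ _ _ _ _ F.toPrelaxFunctorStruct)
      (@PrelaxFunctorStruct.map₂ _ _ _ _ _ _ G.toPrelaxFunctorStruct)) : F = G := by
  obtain ⟨⟨F, _⟩, _, _⟩ := F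
  obtain ⟨⟨G, _⟩, _, _⟩ := G
  obtain rfl : F = G := h
  cases h'
  rfl

theorem inducedPrelax_id :
    inducedPrelax (ContinuousMap.id X) = PrelaxFunctor.id (HomotopyBigroupoid X) := by
  refine prelax_ext rfl (heq_of_eq ?_)
  funext x y p q F
  obtain ⟨F⟩ := F
  exact eq_of_heq (heq_mk _ _ fun _ => rfl)

theorem inducedPrelax_comp {Z : Type u} [TopologicalSpace Z] (f : C(X, Y)) (g : C(Y, Z)) :
    inducedPrelax (g.comp f) = (inducedPrelax f).comp (inducedPrelax g) := by
  refine prelax_ext rfl (heq_of_eq ?_)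
  funext x y p q F
  obtain ⟨F⟩ := F
  exact eq_of_heq (heq_mk _ _ fun _ => rfl)

/-- The strict homomorphism of homotopy bigroupoids induced by a continuous map. -/
def induced (f : C(X, Y)) : StrictPseudofunctor (HomotopyBigroupoid X) (HomotopyBigroupoid Y) :=
  StrictPseudofunctor.mk'
    { toPrelaxFunctor := inducedPrelax f
      map_id := fun _ => rfl
      map_comp := fun p q => Path.map_trans p q f.continuous
      map₂_whisker_left := fun {a _ c} _ _ _ F =>
        (conj_eqToHom_iff_heq (C := (inducedPrelax f).obj a ⟶ (inducedPrelax f).obj c) _ _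
          (Path.map_trans _ _ f.continuous) (Path.map_trans _ _ f.continuous)).2
          (mapTwoTrack_hcomp f _ F)
      map₂_whisker_right := fun {a _ c} _ _ F _ =>
        (conj_eqToHom_iff_heq (C := (inducedPrelax f).obj a ⟶ (inducedPrelax f).obj c) _ _
          (Path.map_trans _ _ f.continuous) (Path.map_trans _ _ f.continuous)).2
          (mapTwoTrack_hcomp f F _)
      map₂_left_unitor := fun {a b} p =>
        eq_eqToHom_comp (C := (inducedPrelax f).obj a ⟶ (inducedPrelax f).obj b) _
          (mapTwoTrack_leftUnitor f p)
      map₂_right_unitor := fun {a b} p =>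
        eq_eqToHom_comp (C := (inducedPrelax f).obj a ⟶ (inducedPrelax f).obj b) _
          (mapTwoTrack_rightUnitor f p)
      map₂_associator := fun {a _ _ d} p q r =>
        (conj_eqToHom_iff_heq' (C := (inducedPrelax f).obj a ⟶ (inducedPrelax f).obj d) _ _ _ _).2
          (mapTwoTrack_associator f p q r) }

end HomotopyBigroupoid

end HomotopyBigroupoid

/-! ### Pointed spaces -/

/-- A pointed topological space. -/
structure PointedSpace : Type (u + 1) where
  carrier : Type u
  [topologicalSpace : TopologicalSpace carrier]
  pt : carrier

namespace PointedSpace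

attribute [instance] topologicalSpace

/-- A pointed continuous map. -/
@[ext]
structure Hom (X Y : PointedSpace.{u}) : Type u where
  toMap : C(X.carrier, Y.carrier)
  map_pt : toMap X.pt = Y.pt

/-- The category of pointed topological spaces. -/
instance : Category.{u} PointedSpace.{u} where
  Hom := Hom
  id _ := ⟨ContinuousMap.id _, rfl⟩
  comp f g := ⟨g.toMap.comp f.toMap, (congrArg g.toMap f.map_pt).trans g.map_pt⟩
  id_comp _ := rfl
  comp_id _ := rfl
  assoc _ _ _ := rfl

end PointedSpace

theorem strictPseudofunctor_ext {B C : Type u} [Bicategory.{u, u} B] [Bicategory.{u, u} C]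
    {F G : StrictPseudofunctor B C} (h : F.toPrelaxFunctor = G.toPrelaxFunctor) :
    F.toPseudofunctor = G.toPseudofunctor := by
  obtain ⟨⟨⟨F, _, _, _, _, _, _, _⟩, hF₁, hF₂⟩, hF₃, hF₄⟩ := F
  obtain ⟨⟨⟨G, _, _, _, _, _, _, _⟩, hG₁, hG₂⟩, hG₃, hG₄⟩ := G
  obtain rfl : F = G := h
  refine PointedBigroupoid.pseudofunctor_ext rfl (heq_of_eq ?_) (heq_of_eq ?_)
  · funext a
    exact (hF₂ a).trans (hG₂ a).symm
  · funext a b c f g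
    exact (hF₄ f g).trans (hG₄ f g).symm

/-- The homotopy bigroupoid of a pointed space, pointed by the basepoint. -/
noncomputable def homotopyBigroupoid : PointedSpace.{u} ⥤ PointedBigroupoid.{u} where
  obj X := { carrier := HomotopyBigroupoid X.carrier, pt := ⟨X.pt⟩ }
  map f :=
    { toPseudofunctor := (HomotopyBigroupoid.induced (PointedSpace.Hom.toMap f)).toPseudofunctor
      obj_pt := congrArg HomotopyBigroupoid.mk (PointedSpace.Hom.map_pt f)
      map_id_pt := rfl }
  map_id _ := PointedBigroupoid.Hom.ext (strictPseudofunctor_ext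
    (F := HomotopyBigroupoid.induced (ContinuousMap.id _)) (G := StrictPseudofunctor.id _)
    HomotopyBigroupoid.inducedPrelax_id)
  map_comp f g := PointedBigroupoid.Hom.ext (strictPseudofunctor_ext
    (G := (HomotopyBigroupoid.induced (PointedSpace.Hom.toMap f)).comp
      (HomotopyBigroupoid.induced (PointedSpace.Hom.toMap g)))
    (HomotopyBigroupoid.inducedPrelax_comp _ _))

/-! ### The fundamental 2-track groupoid of a pointed space -/

noncomputable section LeftTracks

open scoped unitInterval

open PathTrack

/-- The projection of the real line onto the unit interval. -/
def clamp (r : ℝ) : I := Set.projIcc 0 1 zero_le_one r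

theorem continuous_clamp : Continuous clamp := continuous_projIcc (h := zero_le_one)

theorem clamp_coe (t : I) : clamp t = t := Set.projIcc_val _ t

theorem coe_clamp (r : ℝ) : (clamp r : ℝ) = max 0 (min 1 r) := Set.coe_projIcc ..

theorem clamp_of_le_zero {r : ℝ} (h : r ≤ 0) : clamp r = 0 := Set.projIcc_of_le_left _ h

theorem clamp_of_one_le {r : ℝ} (h : 1 ≤ r) : clamp r = 1 := Set.projIcc_of_right_le _ h

variable (X : PointedSpace.{u})

/-- A left path: a path ending in the basepoint. -/
@[ext]
structure LeftPath : Type u where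
  toMap : C(I, X.carrier)
  map_one : toMap 1 = X.pt

variable {X}

/-- A left 2-cube `α` with `d₁⁰ α = a` and `d₂⁰ α = b`. -/
@[ext]
structure LeftCube (a b : LeftPath X) : Type u where
  toMap : C(I × I, X.carrier)
  map_one_left : ∀ t, toMap (1, t) = X.pt
  map_one_right : ∀ t, toMap (t, 1) = X.pt
  source : ∀ t, toMap (0, t) = a.toMap t
  target : ∀ t, toMap (t, 0) = b.toMap t

namespace LeftPath

/-- The constant left path. -/
def zero : LeftPath X := ⟨ContinuousMap.const _ X.pt, rfl⟩

/-- A left path, as a path from its starting point to the basepoint. -/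
def path (a : LeftPath X) {x : X.carrier} (h : a.toMap 0 = x) : Path x X.pt :=
  ⟨a.toMap, h, a.map_one⟩

/-- The left path `a` followed by the constant path at the basepoint. -/
def concatZero (a : LeftPath X) : LeftPath X :=
  ⟨((a.path rfl).trans (Path.refl X.pt)).toContinuousMap,
    ((a.path rfl).trans (Path.refl X.pt)).target⟩

theorem concatZero_apply (a : LeftPath X) (t : I) :
    a.concatZero.toMap t = a.toMap (clamp (2 * t)) := by
  change ((a.path rfl).trans (Path.refl X.pt)) t = _
  rw [Path.trans_apply]
  split_ifs with h
  · refine congrArg a.toMap ?_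
    rw [← clamp_coe (⟨2 * t, _⟩ : I)]
  · rw [clamp_of_one_le (by linarith), a.map_one]
    rfl

end LeftPath

namespace LeftCube

variable {a b c : LeftPath X}

/-- Left 2-tracks are homotopy classes of left 2-cubes relative to the boundary of the square. -/
instance setoid (a b : LeftPath X) : Setoid (LeftCube a b) where
  r α β := ContinuousMap.HomotopicRel α.toMap β.toMap squareBoundary
  iseqv := ⟨fun _ => ContinuousMap.HomotopicRel.refl _,
    fun h => ContinuousMap.HomotopicRel.symm h, fun h h' => ContinuousMap.HomotopicRel.trans h h'⟩

/-- The identity left 2-cube of `a`. On the ray from the origin to a point `y` of the right or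
upper edge, its value at `q y` is `a q`. -/
def id (a : LeftPath X) : LeftCube a a where
  toMap := ⟨fun z => a.toMap (max z.1 z.2), by fun_prop⟩
  map_one_left t := (congrArg a.toMap (max_eq_left (unitInterval.le_one' (t := t)))).trans a.map_one
  map_one_right t :=
    (congrArg a.toMap (max_eq_right (unitInterval.le_one' (t := t)))).trans a.map_one
  source t := congrArg a.toMap (max_eq_right (unitInterval.nonneg' (t := t)))
  target t := congrArg a.toMap (max_eq_left (unitInterval.nonneg' (t := t)))

/-- The inverse of a left 2-cube: the two coordinates are swapped. -/
def symm (α : LeftCube a b) : LeftCube b a where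
  toMap := ⟨fun z => α.toMap (z.2, z.1), by fun_prop⟩
  map_one_left t := α.map_one_right t
  map_one_right t := α.map_one_left t
  source t := α.target t
  target t := α.source t

/-- The map `[0,1] × [-1,1] → X` given by `α` on the upper square, and by `β` on the lower
square after a rotation. -/
def glue (α : LeftCube a b) (β : LeftCube b c) (v : ℝ × ℝ) : X.carrier :=
  if 0 ≤ v.2 then α.toMap (clamp v.1, clamp v.2) else β.toMap (clamp (-v.2), clamp v.1)

theorem continuous_glue (α : LeftCube a b) (β : LeftCube b c) : Continuous (glue α β) := by
  have := continuous_clamp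
  unfold glue
  refine Continuous.if_le (by fun_prop) (by fun_prop) (by fun_prop) (by fun_prop) ?_
  intro v hv
  rw [← hv, neg_zero, clamp_of_le_zero le_rfl, α.target, β.source]

/-- The reparametrization `I² → [0,1] × [-1,1]`: it is linear on rays from the origin, and on the
right and upper edges it is the piecewise linear map with `(0,1) ↦ (0,1)`, `(1/2,1) ↦ (1,1)`,
`(1,1) ↦ (1,0)`, `(1,1/2) ↦ (1,-1)`, `(1,0) ↦ (0,-1)`. -/
def unfoldMap (z : I × I) : ℝ × ℝ :=
  (min (2 * min (z.1 : ℝ) z.2) (max (z.1 : ℝ) z.2), max (-(z.1 : ℝ)) (min (2 * z.2 - 2 * z.1) z.2))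

theorem continuous_unfoldMap : Continuous unfoldMap := by
  unfold unfoldMap
  fun_prop

theorem glue_of_nonneg (α : LeftCube a b) (β : LeftCube b c) {v : ℝ × ℝ} (h : 0 ≤ v.2) :
    glue α β v = α.toMap (clamp v.1, clamp v.2) := if_pos h

theorem glue_of_nonpos (α : LeftCube a b) (β : LeftCube b c) {v : ℝ × ℝ} (h : v.2 ≤ 0) :
    glue α β v = β.toMap (clamp (-v.2), clamp v.1) := by
  rcases eq_or_lt_of_le h with h | h
  · rw [glue_of_nonneg α β h.ge, h, neg_zero, clamp_of_le_zero le_rfl, α.target, β.source]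
  · exact if_neg (not_le.2 h)

theorem map_clamp_left (α : LeftCube a b) {r : ℝ} (h : 1 ≤ r) (t : I) :
    α.toMap (clamp r, t) = X.pt := by
  rw [clamp_of_one_le h, α.map_one_left]

theorem map_clamp_right (α : LeftCube a b) {r : ℝ} (h : 1 ≤ r) (t : I) :
    α.toMap (t, clamp r) = X.pt := by
  rw [clamp_of_one_le h, α.map_one_right]

/-- Composition of left 2-cubes: first `α`, then `β`. -/
def comp (α : LeftCube a b) (β : LeftCube b c) : LeftCube a c where
  toMap := ⟨fun z => glue α β (unfoldMap z), (continuous_glue α β).comp continuous_unfoldMap⟩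
  map_one_left t := by
    have h0 := t.2.1
    have h1 := t.2.2
    change glue α β (unfoldMap (1, t)) = _
    have h : (unfoldMap (1, t)).2 ≤ 0 := by
      simp only [unfoldMap, Set.Icc.coe_one]
      refine max_le (by norm_num) ((min_le_left _ _).trans (by linarith))
    rw [glue_of_nonpos _ _ h]
    rcases le_total (t : ℝ) (1 / 2) with ht | ht
    · refine map_clamp_left _ ?_ _
      simp only [unfoldMap, Set.Icc.coe_one]
      rw [max_eq_left ((min_le_left _ _).trans (by linarith))]
      norm_num
    · refine map_clamp_right _ ?_ _
      simp only [unfoldMap, Set.Icc.coe_one]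
      exact le_min (by rw [min_eq_right h1]; linarith) (le_max_left _ _)
  map_one_right t := by
    have h0 := t.2.1
    have h1 := t.2.2
    change glue α β (unfoldMap (t, 1)) = _
    have h : 0 ≤ (unfoldMap (t, 1)).2 := by
      simp only [unfoldMap, Set.Icc.coe_one]
      exact le_max_of_le_right (le_min (by linarith) zero_le_one)
    rw [glue_of_nonneg _ _ h]
    rcases le_total (t : ℝ) (1 / 2) with ht | ht
    · refine map_clamp_right _ ?_ _
      simp only [unfoldMap, Set.Icc.coe_one]
      exact le_max_of_le_right (le_min (by linarith) le_rfl)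
    · refine map_clamp_left _ ?_ _
      simp only [unfoldMap, Set.Icc.coe_one]
      exact le_min (by rw [min_eq_left h1]; linarith) (le_max_right _ _)
  source t := by
    have h0 := t.2.1
    have h1 := t.2.2
    change glue α β (unfoldMap (0, t)) = _
    have h : unfoldMap (0, t) = (0, (t : ℝ)) := by
      simp only [unfoldMap, Set.Icc.coe_zero]
      have e₁ : min (2 * (t : ℝ) - 2 * 0) t = t := min_eq_right (by linarith)
      have e₂ : max (-0 : ℝ) t = t := max_eq_right (by linarith)
      rw [min_eq_left h0, max_eq_right h0, e₁, e₂, mul_zero, min_eq_left h0]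
    rw [h, glue_of_nonneg _ _ h0, clamp_of_le_zero le_rfl, clamp_coe, α.source]
  target t := by
    have h0 := t.2.1
    have h1 := t.2.2
    change glue α β (unfoldMap (t, 0)) = _
    have h : unfoldMap (t, 0) = (0, -(t : ℝ)) := by
      simp only [unfoldMap, Set.Icc.coe_zero]
      have e₁ : min (2 * 0 - 2 * (t : ℝ)) 0 = -(2 * t) :=
        (min_eq_left (by linarith)).trans (by ring)
      have e₂ : max (-(t : ℝ)) (-(2 * t)) = -t := max_eq_left (by linarith)
      rw [min_eq_right h0, max_eq_left h0, e₁, e₂, mul_zero, min_eq_left h0]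
    rw [h, glue_of_nonpos _ _ (by simpa using h0), clamp_of_le_zero le_rfl, neg_neg, clamp_coe,
      β.target]

end LeftCube

/-! Comparison of left 2-cubes with homotopies of paths. -/

/-- The number `q * min 1 (2 * r)` is a coordinate of the point `q y`. -/
def ray (q r : I) : I := ⟨(q : ℝ) * min 1 (2 * (r : ℝ)), by
  have h := q.2
  have h' := r.2
  have h'' : 0 ≤ min 1 (2 * (r : ℝ)) := le_min zero_le_one (by linarith [h'.1])
  exact ⟨mul_nonneg h.1 h'', mul_le_one₀ h.2 h'' (min_le_left _ _)⟩⟩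

theorem continuous_ray : Continuous fun z : I × I => ray z.1 z.2 := by
  unfold ray
  fun_prop

theorem ray_zero_right (q : I) : ray q 0 = 0 := by ext; simp [ray]

theorem ray_zero_left (r : I) : ray 0 r = 0 := by ext; simp [ray]

theorem ray_of_le (q r : I) (h : (1 : ℝ) / 2 ≤ r) : ray q r = q := by
  ext
  change (q : ℝ) * min 1 (2 * (r : ℝ)) = q
  rw [min_eq_left (by linarith), mul_one]

/-- The map which sends the point `(θ, q)` to `q y`, where `y` runs through the upper edge and
then the right edge of the square. -/
def polarMap (z : I × I) : I × I := (ray z.2 z.1, ray z.2 (σ z.1))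

theorem continuous_polarMap : Continuous polarMap := by
  have h := continuous_ray
  unfold polarMap
  exact (h.comp (by fun_prop : Continuous fun z : I × I => (z.2, z.1))).prodMk
    (h.comp (by fun_prop : Continuous fun z : I × I => (z.2, σ z.1)))

theorem polarMap_zero (q : I) : polarMap (0, q) = (0, q) := by
  refine Prod.ext (ray_zero_right q) ?_
  refine ray_of_le _ _ ?_
  simp
  norm_num

theorem polarMap_one (q : I) : polarMap (1, q) = (q, 0) := by
  refine Prod.ext (ray_of_le _ _ (by norm_num)) ?_
  change ray q (σ 1) = 0
  rw [unitInterval.symm_one, ray_zero_right]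

theorem polarMap_center (t : I) : polarMap (t, 0) = (0, 0) :=
  Prod.ext (ray_zero_left _) (ray_zero_left _)

theorem max_polarMap (z : I × I) : max (polarMap z).1 (polarMap z).2 = z.2 := by
  rcases le_total (z.1 : ℝ) (1 / 2) with h | h
  · have h' : (polarMap z).2 = z.2 := ray_of_le _ _ (by rw [unitInterval.coe_symm_eq]; linarith)
    rw [h', max_eq_right]
    change (z.2 : ℝ) * _ ≤ (z.2 : ℝ)
    exact mul_le_of_le_one_right z.2.2.1 (min_le_left _ _)
  · have h' : (polarMap z).1 = z.2 := ray_of_le _ _ h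
    rw [h', max_eq_left]
    change (z.2 : ℝ) * _ ≤ (z.2 : ℝ)
    exact mul_le_of_le_one_right z.2.2.1 (min_le_left _ _)

theorem polarMap_fiber {z w : I × I} (h : polarMap z = polarMap w) :
    z.2 = w.2 ∧ (z.2 = 0 ∨ z.1 = w.1) := by
  have h2 : z.2 = w.2 := by rw [← max_polarMap z, h, max_polarMap]
  refine ⟨h2, ?_⟩
  by_cases h0 : z.2 = 0
  · exact Or.inl h0
  right
  have h0' : (z.2 : ℝ) ≠ 0 := fun h => h0 (Subtype.ext h)
  have e₁ : (z.2 : ℝ) * min 1 (2 * (z.1 : ℝ)) = w.2 * min 1 (2 * (w.1 : ℝ)) :=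
    congrArg (fun v : I × I => (v.1 : ℝ)) h
  have e₂ : (z.2 : ℝ) * min 1 (2 * (σ z.1 : ℝ)) = w.2 * min 1 (2 * (σ w.1 : ℝ)) :=
    congrArg (fun v : I × I => (v.2 : ℝ)) h
  rw [← h2] at e₁ e₂
  have e₁ := mul_left_cancel₀ h0' e₁
  have e₂ := mul_left_cancel₀ h0' e₂
  rw [unitInterval.coe_symm_eq, unitInterval.coe_symm_eq] at e₂
  ext
  grind

theorem polarMap_surjective : Function.Surjective polarMap := by
  rintro ⟨s, t⟩
  have hs := s.2
  have ht := t.2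
  rcases le_total (s : ℝ) t with h | h
  · rcases eq_or_lt_of_le ht.1 with h0 | h0
    · refine ⟨(0, 0), ?_⟩
      rw [polarMap_center]
      ext
      · change (0 : ℝ) = s
        linarith [hs.1]
      · exact h0
    · have k : (s : ℝ) / t ≤ 1 := (div_le_one h0).2 h
      have k0 : 0 ≤ (s : ℝ) / t := div_nonneg hs.1 ht.1
      refine ⟨(⟨s / t / 2, by linarith, by linarith⟩, t), Prod.ext ?_ ?_⟩
      · ext
        change (t : ℝ) * min 1 (2 * ((s : ℝ) / t / 2)) = s
        rw [mul_div_cancel₀ _ two_ne_zero, min_eq_right k, mul_div_cancel₀ _ h0.ne']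
      · refine ray_of_le _ _ ?_
        change (1 : ℝ) / 2 ≤ 1 - s / t / 2
        linarith
  · rcases eq_or_lt_of_le hs.1 with h0 | h0
    · refine ⟨(0, 0), ?_⟩
      rw [polarMap_center]
      ext
      · exact h0
      · change (0 : ℝ) = t
        linarith [ht.1]
    · have k : (t : ℝ) / s ≤ 1 := (div_le_one h0).2 h
      have k0 : 0 ≤ (t : ℝ) / s := div_nonneg ht.1 hs.1
      refine ⟨(⟨1 - t / s / 2, by linarith, by linarith⟩, s), Prod.ext ?_ ?_⟩
      · refine ray_of_le _ _ ?_
        change (1 : ℝ) / 2 ≤ 1 - t / s / 2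
        linarith
      · ext
        change (s : ℝ) * min 1 (2 * (1 - (1 - (t : ℝ) / s / 2))) = t
        rw [sub_sub_cancel, mul_div_cancel₀ _ two_ne_zero, min_eq_right k,
          mul_div_cancel₀ _ h0.ne']

theorem polarMap_boundary {z : I × I} : polarMap z ∈ squareBoundary ↔ z ∈ squareBoundary := by
  obtain ⟨t, q⟩ := z
  have ht := t.2
  have hq := q.2
  constructor
  · intro h
    by_cases h0 : q = 0
    · exact Or.inr (Or.inr (Or.inl h0))
    have h0' : (q : ℝ) ≠ 0 := fun h => h0 (Subtype.ext h)
    have key : ∀ r : I, ray q r = 0 → r = 0 := by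
      intro r hr
      have h : (q : ℝ) * min 1 (2 * (r : ℝ)) = 0 := congrArg Subtype.val hr
      have h := (mul_eq_zero.1 h).resolve_left h0'
      ext
      change (r : ℝ) = 0
      rcases min_choice (1 : ℝ) (2 * (r : ℝ)) with h' | h' <;> linarith
    have key' : ∀ r : I, ray q r = 1 → q = 1 := by
      intro r hr
      have h : (q : ℝ) * min 1 (2 * (r : ℝ)) = 1 := congrArg Subtype.val hr
      have h' : (q : ℝ) * min 1 (2 * (r : ℝ)) ≤ q :=
        mul_le_of_le_one_right hq.1 (min_le_left _ _)
      ext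
      change (q : ℝ) = 1
      linarith [hq.2]
    rcases h with h | h | h | h
    · exact Or.inl (key _ h)
    · exact Or.inr (Or.inr (Or.inr (key' _ h)))
    · refine Or.inr (Or.inl ?_)
      have := key _ h
      rw [← unitInterval.symm_symm t, this, unitInterval.symm_zero]
    · exact Or.inr (Or.inr (Or.inr (key' _ h)))
  · rintro (h | h | h | h)
    · obtain rfl : t = 0 := h
      rw [polarMap_zero]
      exact Or.inl rfl
    · obtain rfl : t = 1 := h
      rw [polarMap_one]
      exact Or.inr (Or.inr (Or.inl rfl))
    · obtain rfl : q = 0 := h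
      rw [polarMap_center]
      exact Or.inl rfl
    · obtain rfl : q = 1 := h
      rcases max_choice (polarMap (t, 1)).1 (polarMap (t, 1)).2 with h | h
      · exact Or.inr (Or.inl (h.symm.trans (max_polarMap _)))
      · exact Or.inr (Or.inr (Or.inr (h.symm.trans (max_polarMap _))))

/-- A continuous map which is constant on the fibres of `polarMap` descends. -/
theorem exists_descent {Z : Type u} [TopologicalSpace Z] (H : I × I × I → Z) (hH : Continuous H)
    (h : ∀ u t t', H (u, t, 0) = H (u, t', 0)) :
    ∃ K : C(I × I × I, Z), ∀ u z, K (u, polarMap z) = H (u, z) := by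
  let f : C(I × I × I, I × I × I) :=
    ⟨fun z => (z.1, polarMap z.2), by have := continuous_polarMap; fun_prop⟩
  have hf : Topology.IsQuotientMap f :=
    f.continuous.isClosedMap.isQuotientMap f.continuous (by
      rintro ⟨u, z⟩
      obtain ⟨w, rfl⟩ := polarMap_surjective z
      exact ⟨(u, w), rfl⟩)
  have hg : Function.FactorsThrough H f := by
    rintro ⟨u, t, q⟩ ⟨u', t', q'⟩ e
    obtain rfl : u = u' := congrArg Prod.fst e
    obtain ⟨h1, h2⟩ := polarMap_fiber (congrArg Prod.snd e)
    obtain rfl : q = q' := h1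
    rcases h2 with h2 | h2
    · obtain rfl : q = 0 := h2
      exact h _ _ _
    · obtain rfl : t = t' := h2
      rfl
  refine ⟨hf.lift ⟨H, hH⟩ hg, fun u z => ?_⟩
  exact congrArg (fun k : C(I × I × I, Z) => k (u, z)) (hf.lift_comp ⟨H, hH⟩ hg)

namespace LeftCube

variable {a b c : LeftPath X} {x : X.carrier}

theorem start_eq (α : LeftCube a b) : a.toMap 0 = b.toMap 0 := (α.source 0).symm.trans (α.target 0)

/-- The homotopy of paths obtained from a left 2-cube by composition with `polarMap`. -/
def polar (α : LeftCube a b) (ha : a.toMap 0 = x) (hb : b.toMap 0 = x) :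
    Path.Homotopy (a.path ha) (b.path hb) where
  toFun z := α.toMap (polarMap z)
  continuous_toFun := α.toMap.continuous.comp continuous_polarMap
  map_zero_left q := by
    rw [polarMap_zero]
    exact α.source q
  map_one_left q := by
    rw [polarMap_one]
    exact α.target q
  prop' t q hq := by
    change α.toMap (polarMap (t, q)) = a.toMap q
    rcases hq with hq | hq
    · obtain rfl : q = 0 := hq
      rw [polarMap_center]
      exact α.source 0
    · obtain rfl : q = 1 := hq
      rw [a.map_one]
      rcases max_choice (polarMap (t, 1)).1 (polarMap (t, 1)).2 with h | h
      · have h' : polarMap (t, 1) = (1, (polarMap (t, 1)).2) :=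
          Prod.ext (h.symm.trans (max_polarMap _)) rfl
        rw [h', α.map_one_left]
      · have h' : polarMap (t, 1) = ((polarMap (t, 1)).1, 1) :=
          Prod.ext rfl (h.symm.trans (max_polarMap _))
        rw [h', α.map_one_right]

theorem polar_apply (α : LeftCube a b) (ha : a.toMap 0 = x) (hb : b.toMap 0 = x) (z : I × I) :
    α.polar ha hb z = α.toMap (polarMap z) := rfl

theorem polar_rel_iff {α β : LeftCube a b} (ha : a.toMap 0 = x) (hb : b.toMap 0 = x) :
    α.polar ha hb ≈ β.polar ha hb ↔ α ≈ β := by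
  constructor
  · rintro ⟨H⟩
    obtain ⟨K, hK⟩ := exists_descent H H.continuous (by
      intro u t t'
      have h : ∀ t, H (u, t, 0) = x := fun t =>
        (H.eq_fst u (Or.inr (Or.inr (Or.inl rfl)))).trans ((α.polar ha hb).source t)
      rw [h, h])
    refine ⟨⟨⟨K, ?_, ?_⟩, ?_⟩⟩
    · intro z
      obtain ⟨w, rfl⟩ := polarMap_surjective z
      exact (hK _ _).trans (H.apply_zero w)
    · intro z
      obtain ⟨w, rfl⟩ := polarMap_surjective z
      exact (hK _ _).trans (H.apply_one w)
    · intro u z hz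
      obtain ⟨w, rfl⟩ := polarMap_surjective z
      exact (hK _ _).trans (H.eq_fst u (polarMap_boundary.1 hz))
  · rintro ⟨K⟩
    refine ⟨⟨⟨⟨fun z => K (z.1, polarMap z.2), by have := continuous_polarMap; fun_prop⟩,
      ?_, ?_⟩, ?_⟩⟩
    · intro z
      exact K.apply_zero _
    · intro z
      exact K.apply_one _
    · intro u z hz
      exact K.eq_fst u (polarMap_boundary.2 hz)

theorem exists_polar (ha : a.toMap 0 = x) (hb : b.toMap 0 = x)
    (F : Path.Homotopy (a.path ha) (b.path hb)) : ∃ α : LeftCube a b, α.polar ha hb = F := by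
  obtain ⟨K, hK⟩ := exists_descent (fun z => F z.2) (F.continuous.comp continuous_snd) (by
    intro u t t'
    rw [F.source, F.source])
  have h1 : ∀ z : I × I, max z.1 z.2 = 1 → K (0, z) = X.pt := by
    intro z hz
    obtain ⟨⟨t, q⟩, rfl⟩ := polarMap_surjective z
    rw [max_polarMap] at hz
    obtain rfl : q = 1 := hz
    exact (hK 0 _).trans (F.target t)
  refine ⟨⟨⟨fun z => K (0, z), by fun_prop⟩, fun t => h1 _ (max_eq_left unitInterval.le_one'),
    fun t => h1 _ (max_eq_right unitInterval.le_one'), fun t => ?_, fun t => ?_⟩, ?_⟩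
  · change K (0, (0, t)) = _
    rw [← polarMap_zero]
    exact (hK 0 _).trans (F.apply_zero t)
  · change K (0, (t, 0)) = _
    rw [← polarMap_one]
    exact (hK 0 _).trans (F.apply_one t)
  · ext z
    exact hK 0 z

theorem polar_id (ha : a.toMap 0 = x) : (id a).polar ha ha = Path.Homotopy.refl (a.path ha) := by
  ext z
  exact congrArg a.toMap (max_polarMap z)

theorem polar_symm (α : LeftCube a b) (ha : a.toMap 0 = x) (hb : b.toMap 0 = x) :
    α.symm.polar hb ha = (α.polar ha hb).symm := by
  ext z
  refine Eq.trans ?_ (Path.Homotopy.symm_apply _ z).symm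
  change α.toMap (ray z.2 (σ z.1), ray z.2 z.1) = α.toMap (ray z.2 (σ z.1), ray z.2 (σ (σ z.1)))
  rw [unitInterval.symm_symm]

theorem unfoldMap_polarMap_of_le (t q : I) (h : (t : ℝ) ≤ 1 / 2) :
    unfoldMap (polarMap (t, q)) = ((q : ℝ) * min 1 (4 * (t : ℝ)), (q : ℝ) * min 1 (2 - 4 * (t : ℝ))) := by
  have ht := t.2
  have hq := q.2
  have hm : (polarMap (t, q)).1 = (q : ℝ) * (2 * t) := by
    change (q : ℝ) * min 1 (2 * (t : ℝ)) = _
    rw [min_eq_right (by linarith)]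
  have hn : ((polarMap (t, q)).2 : ℝ) = q := congrArg Subtype.val
    (ray_of_le q (σ t) (by rw [unitInterval.coe_symm_eq]; linarith))
  have e : (q : ℝ) * (2 * t) ≤ q := mul_le_of_le_one_right hq.1 (by linarith)
  have e' : 0 ≤ (q : ℝ) * (2 * t) := by have := ht.1; have := hq.1; positivity
  have e'' : 0 ≤ (q : ℝ) * min 1 (2 - 4 * (t : ℝ)) := mul_nonneg hq.1 (le_min zero_le_one (by linarith))
  unfold unfoldMap
  rw [hm, hn, min_eq_left e, max_eq_right e]
  refine Prod.ext ?_ ?_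
  · change min (2 * ((q : ℝ) * (2 * t))) q = q * min 1 (4 * (t : ℝ))
    rw [mul_min_of_nonneg _ _ hq.1, min_comm]
    ring_nf
  · change max (-((q : ℝ) * (2 * t))) (min (2 * q - 2 * (q * (2 * t))) q) = _
    have k : min (2 * (q : ℝ) - 2 * (q * (2 * t))) q = q * min 1 (2 - 4 * (t : ℝ)) := by
      rw [mul_min_of_nonneg _ _ hq.1, min_comm]
      ring_nf
    rw [k, max_eq_right (by linarith)]

theorem unfoldMap_polarMap_of_ge (t q : I) (h : (1 : ℝ) / 2 ≤ t) :
    unfoldMap (polarMap (t, q)) = ((q : ℝ) * min 1 (4 - 4 * (t : ℝ)), -((q : ℝ) * min 1 (4 * (t : ℝ) - 2))) := by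
  have ht := t.2
  have hq := q.2
  have hm : ((polarMap (t, q)).1 : ℝ) = q := congrArg Subtype.val (ray_of_le q t h)
  have hn : (polarMap (t, q)).2 = (q : ℝ) * (2 - 2 * t) := by
    change (q : ℝ) * min 1 (2 * (1 - (t : ℝ))) = _
    rw [min_eq_right (by linarith)]
    ring
  have e : (q : ℝ) * (2 - 2 * t) ≤ q := mul_le_of_le_one_right hq.1 (by linarith)
  have e' : 0 ≤ (q : ℝ) * (2 - 2 * t) := mul_nonneg hq.1 (by linarith [ht.2])
  unfold unfoldMap
  rw [hm, hn, min_eq_right e, max_eq_left e]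
  refine Prod.ext ?_ ?_
  · change min (2 * ((q : ℝ) * (2 - 2 * t))) q = q * min 1 (4 - 4 * (t : ℝ))
    rw [mul_min_of_nonneg _ _ hq.1, min_comm]
    ring_nf
  · change max (-(q : ℝ)) (min (2 * (q * (2 - 2 * t)) - 2 * q) (q * (2 - 2 * t))) = _
    have k : min (2 * ((q : ℝ) * (2 - 2 * t)) - 2 * q) (q * (2 - 2 * t)) = -(q * (4 * t - 2)) := by
      rw [min_eq_left]
      · ring
      · nlinarith [ht.2, hq.1]
    rw [k, max_neg_neg]
    change -min (q : ℝ) _ = -((q : ℝ) * min 1 (4 * (t : ℝ) - 2))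
    rw [mul_min_of_nonneg _ _ hq.1, mul_one]

theorem polar_comp (α : LeftCube a b) (β : LeftCube b c) (ha : a.toMap 0 = x)
    (hb : b.toMap 0 = x) (hc : c.toMap 0 = x) :
    (α.comp β).polar ha hc = (α.polar ha hb).trans (β.polar hb hc) := by
  ext z
  obtain ⟨t, q⟩ := z
  have ht := t.2
  have hq := q.2
  refine Eq.trans ?_ (Path.Homotopy.trans_apply _ _ _).symm
  change glue α β (unfoldMap (polarMap (t, q))) = _
  have key : ∀ (r s : ℝ) (v : I), r = v → s = 2 * v → clamp (q * min 1 s) = ray q v := by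
    rintro r s v rfl rfl
    rw [← clamp_coe (ray q v)]
    rfl
  have key : ∀ (s : ℝ) (v : I), s = 2 * v → clamp (q * min 1 s) = ray q v :=
    fun s v h => key _ s v rfl h
  split_ifs with h
  · rw [unfoldMap_polarMap_of_le _ _ h, glue_of_nonneg _ _
      (mul_nonneg hq.1 (le_min zero_le_one (by linarith)))]
    refine congrArg α.toMap (Prod.ext (key _ _ ?_) (key _ _ ?_))
    · change 4 * (t : ℝ) = 2 * (2 * t)
      ring
    · change 2 - 4 * (t : ℝ) = 2 * (1 - 2 * t)
      ring
  · have h := (not_le.1 h).le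
    rw [unfoldMap_polarMap_of_ge _ _ h, glue_of_nonpos _ _
      (neg_nonpos.2 (mul_nonneg hq.1 (le_min zero_le_one (by linarith)))), neg_neg]
    refine congrArg β.toMap (Prod.ext (key _ _ ?_) (key _ _ ?_))
    · change 4 * (t : ℝ) - 2 = 2 * (2 * t - 1)
      ring
    · change 4 - 4 * (t : ℝ) = 2 * (1 - (2 * t - 1))
      ring

end LeftCube

/-- A left 2-track: a homotopy class of left 2-cubes. -/
def LeftTrack (a b : LeftPath X) : Type u := Quotient (LeftCube.setoid a b)

namespace LeftTrack

variable {a b c d : LeftPath X} {x : X.carrier}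

/-- The class of a left 2-cube. -/
def mk (α : LeftCube a b) : LeftTrack a b := Quotient.mk _ α

/-- The comparison with 2-tracks between paths. -/
def toTwoTrack (ha : a.toMap 0 = x) (hb : b.toMap 0 = x) :
    LeftTrack a b → TwoTrack (a.path ha) (b.path hb) :=
  Quotient.map (fun α => α.polar ha hb) (fun _ _ h => (LeftCube.polar_rel_iff ha hb).2 h)

theorem toTwoTrack_mk (ha : a.toMap 0 = x) (hb : b.toMap 0 = x) (α : LeftCube a b) :
    toTwoTrack ha hb (mk α) = TwoTrack.mk (α.polar ha hb) := rfl

theorem toTwoTrack_bijective (ha : a.toMap 0 = x) (hb : b.toMap 0 = x) :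
    Function.Bijective (toTwoTrack ha hb) := by
  constructor
  · rintro ⟨α⟩ ⟨β⟩ h
    exact Quotient.sound ((LeftCube.polar_rel_iff ha hb).1 (Quotient.exact h))
  · rintro ⟨F⟩
    obtain ⟨α, rfl⟩ := LeftCube.exists_polar ha hb F
    exact ⟨mk α, rfl⟩

theorem start_eq : LeftTrack a b → a.toMap 0 = b.toMap 0 := by
  rintro ⟨α⟩
  exact α.start_eq

/-- Composition of left 2-tracks. -/
def comp : LeftTrack a b → LeftTrack b c → LeftTrack a c :=
  Quotient.map₂ LeftCube.comp (by
    intro α α' h β β' h'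
    have e := β.start_eq
    refine (LeftCube.polar_rel_iff α.start_eq e.symm).1 ?_
    rw [LeftCube.polar_comp _ _ _ rfl, LeftCube.polar_comp _ _ _ rfl, rel_iff, pathOf_trans,
      pathOf_trans]
    exact (rel_iff.1 ((LeftCube.polar_rel_iff _ _).2 h)).hcomp
      (rel_iff.1 ((LeftCube.polar_rel_iff _ _).2 h')))

/-- The inverse of a left 2-track. -/
def symm : LeftTrack a b → LeftTrack b a :=
  Quotient.map LeftCube.symm (by
    intro α α' h
    refine (LeftCube.polar_rel_iff (α.start_eq.symm) rfl).1 ?_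
    rw [LeftCube.polar_symm, LeftCube.polar_symm, rel_iff, pathOf_symm, pathOf_symm]
    exact (rel_iff.1 ((LeftCube.polar_rel_iff _ _).2 h)).symm₂)

theorem toTwoTrack_comp (ha : a.toMap 0 = x) (hb : b.toMap 0 = x) (hc : c.toMap 0 = x)
    (α : LeftTrack a b) (β : LeftTrack b c) :
    toTwoTrack ha hc (comp α β) = (toTwoTrack ha hb α).comp (toTwoTrack hb hc β) := by
  obtain ⟨α⟩ := α
  obtain ⟨β⟩ := β
  exact congrArg TwoTrack.mk (LeftCube.polar_comp α β ha hb hc)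

theorem toTwoTrack_symm (ha : a.toMap 0 = x) (hb : b.toMap 0 = x) (α : LeftTrack a b) :
    toTwoTrack hb ha (symm α) = (toTwoTrack ha hb α).symm := by
  obtain ⟨α⟩ := α
  exact congrArg TwoTrack.mk (LeftCube.polar_symm α ha hb)

theorem toTwoTrack_id (ha : a.toMap 0 = x) :
    toTwoTrack ha ha (mk (LeftCube.id a)) = TwoTrack.mk (Path.Homotopy.refl (a.path ha)) :=
  congrArg TwoTrack.mk (LeftCube.polar_id ha)

end LeftTrack

/-- The groupoid of left paths and left 2-tracks. -/
instance : Groupoid.{u} (LeftPath X) where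
  Hom a b := LeftTrack a b
  id a := LeftTrack.mk (LeftCube.id a)
  comp α β := LeftTrack.comp α β
  inv α := LeftTrack.symm α
  id_comp {a b} α := by
    have h := LeftTrack.start_eq α
    refine (LeftTrack.toTwoTrack_bijective h rfl).1 ?_
    refine (LeftTrack.toTwoTrack_comp h h rfl _ α).trans ?_
    rw [LeftTrack.toTwoTrack_id]
    exact TwoTrack.id_comp _
  comp_id {a b} α := by
    have h := LeftTrack.start_eq α
    refine (LeftTrack.toTwoTrack_bijective h rfl).1 ?_
    refine (LeftTrack.toTwoTrack_comp h rfl rfl α _).trans ?_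
    rw [LeftTrack.toTwoTrack_id]
    exact TwoTrack.comp_id _
  assoc {a b c d} α β γ := by
    have h := LeftTrack.start_eq γ
    have h' := (LeftTrack.start_eq β).trans h
    have h'' := (LeftTrack.start_eq α).trans h'
    refine (LeftTrack.toTwoTrack_bijective h'' rfl).1 ?_
    refine (LeftTrack.toTwoTrack_comp h'' h rfl _ γ).trans ?_
    refine Eq.trans ?_ (LeftTrack.toTwoTrack_comp h'' h' rfl α _).symm
    rw [LeftTrack.toTwoTrack_comp h'' h' h, LeftTrack.toTwoTrack_comp h' h rfl]
    exact TwoTrack.assoc _ _ _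
  inv_comp {a b} α := by
    have h := LeftTrack.start_eq α
    refine (LeftTrack.toTwoTrack_bijective rfl rfl).1 ?_
    refine (LeftTrack.toTwoTrack_comp rfl h rfl _ α).trans ?_
    rw [LeftTrack.toTwoTrack_symm h rfl, LeftTrack.toTwoTrack_id]
    exact TwoTrack.symm_comp _
  comp_inv {a b} α := by
    have h := LeftTrack.start_eq α
    refine (LeftTrack.toTwoTrack_bijective h h).1 ?_
    refine (LeftTrack.toTwoTrack_comp h rfl h α _).trans ?_
    rw [LeftTrack.toTwoTrack_symm h rfl, LeftTrack.toTwoTrack_id]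
    exact TwoTrack.comp_symm _

namespace LeftCube

variable {a b c : LeftPath X} {x : X.carrier}

/-- The reparametrization left 2-cube from `a` to `a` followed by the constant path. -/
def stretch (a : LeftPath X) : LeftCube a a.concatZero where
  toMap := ⟨fun z => a.toMap (clamp (max (2 * (z.1 : ℝ)) z.2)), by
    have := continuous_clamp
    fun_prop⟩
  map_one_left t := by
    refine (congrArg a.toMap (clamp_of_one_le (le_max_of_le_left ?_))).trans a.map_one
    norm_num
  map_one_right t :=
    (congrArg a.toMap (clamp_of_one_le (le_max_of_le_right le_rfl))).trans a.map_one
  source t := by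
    refine congrArg a.toMap ?_
    rw [← clamp_coe t]
    refine congrArg clamp ?_
    rw [clamp_coe]
    refine max_eq_right ?_
    have := t.2.1
    simpa using this
  target t := by
    rw [LeftPath.concatZero_apply]
    refine congrArg a.toMap (congrArg clamp (max_eq_left ?_))
    have := t.2.1
    simpa using this

/-- The map `[0,2]² → X` which is the identity left 2-cube of `a` on the lower left square, is
`α` on the upper right square, and is constant on the two other squares. -/
def graftMap (a : LeftPath X) (α : LeftCube (LeftPath.zero : LeftPath X) LeftPath.zero)
    (v : ℝ × ℝ) : X.carrier :=
  if max v.1 v.2 ≤ 1 then a.toMap (clamp (max v.1 v.2))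
  else α.toMap (clamp (v.1 - 1), clamp (v.2 - 1))

theorem continuous_graftMap (a : LeftPath X) (α : LeftCube LeftPath.zero LeftPath.zero) :
    Continuous (graftMap a α) := by
  have := continuous_clamp
  unfold graftMap
  refine Continuous.if_le (by fun_prop) (by fun_prop) (by fun_prop) (by fun_prop) ?_
  intro v hv
  have h1 : v.1 ≤ 1 := (le_max_left _ _).trans hv.le
  have h2 : v.2 ≤ 1 := (le_max_right _ _).trans hv.le
  rw [hv, clamp_of_one_le le_rfl, clamp_of_le_zero (by linarith), clamp_of_le_zero (by linarith),
    a.map_one, α.source]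
  rfl

theorem graftMap_zero_left (a : LeftPath X) (α : LeftCube LeftPath.zero LeftPath.zero) (t : I) :
    graftMap a α (0, 2 * t) = a.concatZero.toMap t := by
  have ht := t.2.1
  have h : max (0 : ℝ) (2 * t) = 2 * t := max_eq_right (by linarith)
  rw [LeftPath.concatZero_apply]
  unfold graftMap
  simp only [h]
  split_ifs with h1
  · rfl
  · rw [clamp_of_le_zero (by norm_num), α.source, clamp_of_one_le (r := 2 * (t : ℝ)) (by linarith), a.map_one]
    rfl

theorem graftMap_zero_right (a : LeftPath X) (α : LeftCube LeftPath.zero LeftPath.zero) (t : I) :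
    graftMap a α (2 * t, 0) = a.concatZero.toMap t := by
  have ht := t.2.1
  have h : max (2 * (t : ℝ)) 0 = 2 * t := max_eq_left (by linarith)
  rw [LeftPath.concatZero_apply]
  unfold graftMap
  simp only [h]
  split_ifs with h1
  · rfl
  · rw [clamp_of_le_zero (r := 0 - 1) (by norm_num), α.target, clamp_of_one_le (r := 2 * (t : ℝ)) (by linarith),
      a.map_one]
    rfl

/-- The left 2-cube obtained from `graftMap` by rescaling. -/
def graft (a : LeftPath X) (α : LeftCube (LeftPath.zero : LeftPath X) LeftPath.zero) :
    LeftCube a.concatZero a.concatZero where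
  toMap := ⟨fun z => graftMap a α (2 * z.1, 2 * z.2), (continuous_graftMap a α).comp (by fun_prop)⟩
  map_one_left t := by
    change graftMap a α (2 * (1 : ℝ), 2 * t) = _
    have h : ¬ max (2 * (1 : ℝ)) (2 * t) ≤ 1 := fun h => by
      have := (le_max_left _ _).trans h
      norm_num at this
    refine (if_neg h).trans ?_
    exact α.map_clamp_left (by norm_num) _
  map_one_right t := by
    change graftMap a α (2 * t, 2 * (1 : ℝ)) = _
    have h : ¬ max (2 * (t : ℝ)) (2 * 1) ≤ 1 := fun h => by
      have := (le_max_right _ _).trans h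
      norm_num at this
    refine (if_neg h).trans ?_
    exact α.map_clamp_right (by norm_num) _
  source t := by
    rw [← graftMap_zero_left a α t]
    change graftMap a α (2 * (0 : ℝ), 2 * t) = _
    rw [mul_zero]
  target t := by
    rw [← graftMap_zero_right a α t]
    change graftMap a α (2 * t, 2 * (0 : ℝ)) = _
    rw [mul_zero]

/-- The left 2-cube from `a` to `a` defining the inverse of the structural isomorphism `ψ`: the
identity of `a` near the origin, with `α` attached at the opposite corner. Since the left and lower
edges of `graft a α` are `a` followed by a constant path, it is conjugated with the
reparametrization `stretch a`, to obtain a left 2-cube whose left and lower edges are `a`. -/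
def psiInv (a : LeftPath X) (α : LeftCube (LeftPath.zero : LeftPath X) LeftPath.zero) :
    LeftCube a a :=
  ((stretch a).comp (graft a α)).comp (stretch a).symm

theorem mix_eq (t r s : I) (h : r = s) : mix t r s = r := by
  subst h
  ext
  change (1 - (t : ℝ)) * r + t * r = r
  ring

theorem mix_zero (r s : I) : mix 0 r s = r := by
  ext
  change (1 - (0 : ℝ)) * r + 0 * s = r
  ring

theorem mix_one (r s : I) : mix 1 r s = s := by
  ext
  change (1 - (1 : ℝ)) * r + 1 * s = s
  ring

theorem continuous_mix : Continuous fun w : I × I × I => mix w.1 w.2.1 w.2.2 := by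
  unfold mix
  fun_prop

/-- The parameter of `stretch` in polar coordinates. -/
def stretchParam (z : I × I) : I := clamp (max (2 * ((polarMap z).1 : ℝ)) (polarMap z).2)

theorem continuous_stretchParam : Continuous stretchParam := by
  have := continuous_clamp
  have := continuous_polarMap
  unfold stretchParam
  fun_prop

theorem rightParam_start (q : I) : rightParam (0, q) = clamp (2 * q) := by
  have hq := q.2.1
  have h : rightParam (0, q) =
      ⟨Path.Homotopy.transReflReparamAux q, Path.Homotopy.transReflReparamAux_mem_I q⟩ := by
    unfold rightParam
    rw [unitInterval.symm_zero, mix_one]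
  rw [h]
  ext
  rw [coe_clamp]
  change Path.Homotopy.transReflReparamAux q = _
  unfold Path.Homotopy.transReflReparamAux
  split_ifs with h'
  · rw [min_eq_right (by linarith), max_eq_right (by linarith)]
  · rw [min_eq_left (by linarith), max_eq_right (by linarith)]

theorem rightParam_end (q : I) : rightParam (1, q) = q := by
  unfold rightParam
  rw [unitInterval.symm_one, mix_zero]

theorem stretchParam_boundary {z : I × I} (hz : z ∈ squareBoundary) :
    stretchParam z = rightParam (σ z.1, z.2) := by
  obtain ⟨t, q⟩ := z
  have hq := q.2.1
  unfold stretchParam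
  rcases hz with h | h | h | h
  · obtain rfl : t = 0 := h
    rw [polarMap_zero]
    simp only [unitInterval.symm_zero, Set.Icc.coe_zero, mul_zero]
    rw [max_eq_right hq, clamp_coe, rightParam_end]
  · obtain rfl : t = 1 := h
    rw [polarMap_one]
    simp only [unitInterval.symm_one, Set.Icc.coe_zero]
    rw [max_eq_left (by linarith), rightParam_start]
  · obtain rfl : q = 0 := h
    rw [polarMap_center]
    simp only [Set.Icc.coe_zero, mul_zero, max_self]
    rw [clamp_of_le_zero le_rfl, rightParam_zero]
  · obtain rfl : q = 1 := h
    simp only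
    rw [rightParam_one]
    refine clamp_of_one_le ?_
    have h0 := (polarMap (t, 1)).1.2.1
    rcases max_choice (polarMap (t, 1)).1 (polarMap (t, 1)).2 with h | h
    · have h' : ((polarMap (t, 1)).1 : ℝ) = 1 :=
        congrArg Subtype.val (h.symm.trans (max_polarMap _))
      exact le_max_of_le_left (by linarith)
    · have h' : ((polarMap (t, 1)).2 : ℝ) = 1 :=
        congrArg Subtype.val (h.symm.trans (max_polarMap _))
      exact le_max_of_le_right h'.ge

theorem polar_stretch (a : LeftPath X) (h : a.concatZero.toMap 0 = a.toMap 0) :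
    TwoTrack.mk ((stretch a).polar rfl h) = (TwoTrack.rightUnitor (a.path rfl)).symm := by
  suffices key : (PathTrack.setoid (a.path rfl) ((a.path rfl).trans (Path.refl X.pt))).r
      ((stretch a).polar rfl h) (Path.Homotopy.transRefl (a.path rfl)).symm from
    Quotient.sound key
  refine ⟨⟨⟨⟨fun w => a.toMap
    (mix w.1 (stretchParam w.2) (rightParam (σ w.2.1, w.2.2))), ?_⟩, ?_, ?_⟩, ?_⟩⟩
  · have h1 := continuous_mix
    have h2 := continuous_stretchParam
    have h3 := continuous_rightParam
    exact a.toMap.continuous.comp (h1.comp (by fun_prop :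
      Continuous fun w : I × I × I => (w.1, stretchParam w.2, rightParam (σ w.2.1, w.2.2))))
  · intro z
    exact congrArg a.toMap (mix_zero _ _)
  · intro z
    refine (congrArg a.toMap (mix_one _ _)).trans ?_
    exact (Path.Homotopy.symm_apply (Path.Homotopy.transRefl (a.path rfl)) z).symm
  · intro u z hz
    exact congrArg a.toMap (mix_eq _ _ _ (stretchParam_boundary hz))

/-- A coordinate of the homotopy between the two ways to attach a left 2-cube to a left path. -/
def graftCoord (u q r : I) : I :=
  clamp (2 * q * min 1 (2 * (r : ℝ)) - ((1 - u) + u * min 1 (2 * (r : ℝ))))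

theorem continuous_graftCoord : Continuous fun w : I × I × I => graftCoord w.1 w.2.1 w.2.2 := by
  have := continuous_clamp
  unfold graftCoord
  fun_prop

theorem graftCoord_half (u q r : I) (hq : (q : ℝ) = 1 / 2) : graftCoord u q r = 0 := by
  refine clamp_of_le_zero ?_
  rw [hq]
  have := min_le_left (1 : ℝ) (2 * (r : ℝ))
  nlinarith [u.2.1, u.2.2]

theorem graftCoord_zero (u q : I) : graftCoord u q 0 = 0 := by
  refine clamp_of_le_zero ?_
  have h : min (1 : ℝ) (2 * ((0 : I) : ℝ)) = 0 := by simp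
  rw [h]
  linarith [u.2.2]

theorem graftCoord_one (u r : I) (hr : (1 : ℝ) / 2 ≤ r) : graftCoord u 1 r = 1 := by
  refine clamp_of_one_le ?_
  rw [min_eq_left (by linarith)]
  simp only [Set.Icc.coe_one]
  linarith

/-- The homotopy between the two ways to attach a left 2-cube to a left path. -/
def graftHomotopy (a : LeftPath X) (α : LeftCube (LeftPath.zero : LeftPath X) LeftPath.zero)
    (w : I × I × I) : X.carrier :=
  if (w.2.2 : ℝ) ≤ 1 / 2 then a.toMap (clamp (2 * w.2.2))
  else α.toMap (graftCoord w.1 w.2.2 w.2.1, graftCoord w.1 w.2.2 (σ w.2.1))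

theorem continuous_graftHomotopy (a : LeftPath X)
    (α : LeftCube (LeftPath.zero : LeftPath X) LeftPath.zero) :
    Continuous (graftHomotopy a α) := by
  have := continuous_clamp
  have h1 : Continuous fun w : I × I × I => graftCoord w.1 w.2.2 w.2.1 :=
    continuous_graftCoord.comp (by fun_prop : Continuous fun w : I × I × I => (w.1, w.2.2, w.2.1))
  have h2 : Continuous fun w : I × I × I => graftCoord w.1 w.2.2 (σ w.2.1) :=
    continuous_graftCoord.comp
      (by fun_prop : Continuous fun w : I × I × I => (w.1, w.2.2, σ w.2.1))
  unfold graftHomotopy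
  refine Continuous.if_le (by fun_prop) (by fun_prop) (by fun_prop) (by fun_prop) ?_
  intro w hw
  rw [graftCoord_half _ _ _ hw, graftCoord_half _ _ _ hw, α.source, clamp_of_one_le (by linarith),
    a.map_one]
  rfl

theorem graftHomotopy_boundary (a : LeftPath X)
    (α : LeftCube (LeftPath.zero : LeftPath X) LeftPath.zero) (u : I) {z : I × I}
    (hz : z ∈ squareBoundary) : graftHomotopy a α (u, z) = a.toMap (clamp (2 * z.2)) := by
  obtain ⟨t, q⟩ := z
  unfold graftHomotopy
  split_ifs with h
  · rfl
  · simp only at h ⊢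
    rw [clamp_of_one_le (r := 2 * (q : ℝ)) (by linarith), a.map_one]
    rcases hz with hz | hz | hz | hz
    · obtain rfl : t = 0 := hz
      rw [graftCoord_zero, α.source]
      rfl
    · obtain rfl : t = 1 := hz
      rw [unitInterval.symm_one, graftCoord_zero, α.target]
      rfl
    · obtain rfl : q = 0 := hz
      exact absurd (by norm_num : ((0 : I) : ℝ) ≤ 1 / 2) h
    · obtain rfl : q = 1 := hz
      rcases le_total ((1 : ℝ) / 2) t with ht | ht
      · rw [graftCoord_one _ _ ht, α.map_one_left]
      · have ht' : (1 : ℝ) / 2 ≤ (σ t : I) := by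
          rw [unitInterval.coe_symm_eq]
          linarith
        rw [graftCoord_one _ _ ht', α.map_one_right]

theorem graftHomotopy_zero (a : LeftPath X)
    (α : LeftCube (LeftPath.zero : LeftPath X) LeftPath.zero) (z : I × I) :
    graftHomotopy a α (0, z) = (graft a α).toMap (polarMap z) := by
  obtain ⟨t, q⟩ := z
  have hm : max (2 * ((polarMap (t, q)).1 : ℝ)) (2 * (polarMap (t, q)).2) = 2 * q := by
    rw [← mul_max_of_nonneg _ _ zero_le_two]
    exact congrArg (fun r : I => 2 * (r : ℝ)) (max_polarMap (t, q))
  have key : ∀ r : I, graftCoord 0 q r = clamp (2 * (ray q r : ℝ) - 1) := by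
    intro r
    refine congrArg clamp ?_
    change 2 * (q : ℝ) * min 1 (2 * (r : ℝ)) - ((1 - (0 : ℝ)) + 0 * min 1 (2 * (r : ℝ))) =
      2 * ((q : ℝ) * min 1 (2 * (r : ℝ))) - 1
    ring
  change _ = graftMap a α (2 * ((polarMap (t, q)).1 : ℝ), 2 * ((polarMap (t, q)).2 : ℝ))
  unfold graftHomotopy graftMap
  simp only [hm]
  by_cases h : (q : ℝ) ≤ 1 / 2
  · rw [if_pos h, if_pos (by linarith)]
  · rw [if_neg h, if_neg (fun h' => h (by linarith)), key, key]
    rfl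

theorem graftHomotopy_one (a : LeftPath X)
    (α : LeftCube (LeftPath.zero : LeftPath X) LeftPath.zero) (z : I × I) :
    graftHomotopy a α (1, z) =
      ((Path.Homotopy.refl (a.path rfl)).hcomp (α.polar rfl rfl)) z := by
  obtain ⟨t, q⟩ := z
  refine Eq.trans ?_ (Path.Homotopy.hcomp_apply _ _ _).symm
  unfold graftHomotopy
  simp only
  split_ifs with h
  · exact congrArg a.toMap (clamp_coe ⟨2 * q, (unitInterval.mul_pos_mem_iff zero_lt_two).2
      ⟨q.2.1, h⟩⟩)
  · have key : ∀ r : I, graftCoord 1 q r = ray ⟨2 * q - 1,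
        unitInterval.two_mul_sub_one_mem_iff.2 ⟨(not_le.1 h).le, q.2.2⟩⟩ r := by
      intro r
      rw [← clamp_coe (ray _ r)]
      refine congrArg clamp ?_
      change 2 * (q : ℝ) * min 1 (2 * (r : ℝ)) - ((1 - (1 : ℝ)) + 1 * min 1 (2 * (r : ℝ))) =
        (2 * (q : ℝ) - 1) * min 1 (2 * (r : ℝ))
      ring
    rw [key, key]
    rfl

theorem polar_graft (a : LeftPath X) (α : LeftCube (LeftPath.zero : LeftPath X) LeftPath.zero)
    (h : a.concatZero.toMap 0 = a.toMap 0) :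
    TwoTrack.mk ((graft a α).polar h h) =
      TwoTrack.hcomp (TwoTrack.mk (Path.Homotopy.refl (a.path rfl)))
        (TwoTrack.mk (α.polar rfl rfl)) := by
  suffices key : (PathTrack.setoid ((a.path rfl).trans (Path.refl X.pt))
      ((a.path rfl).trans (Path.refl X.pt))).r ((graft a α).polar h h)
        ((Path.Homotopy.refl (a.path rfl)).hcomp (α.polar rfl rfl)) from
    Quotient.sound key
  refine ⟨⟨⟨⟨graftHomotopy a α, continuous_graftHomotopy a α⟩,
    ?_, ?_⟩, ?_⟩⟩
  · exact graftHomotopy_zero a α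
  · exact graftHomotopy_one a α
  · intro u z hz
    refine (graftHomotopy_boundary a α u hz).trans ?_
    refine Eq.trans ?_ (graftHomotopy_zero a α z)
    exact (graftHomotopy_boundary a α 0 hz).symm

end LeftCube

namespace LeftPath

theorem concatZero_start (a : LeftPath X) : a.concatZero.toMap 0 = a.toMap 0 :=
  ((a.path rfl).trans (Path.refl X.pt)).source

/-- A left path as a 1-morphism of the homotopy bigroupoid. -/
def hom (a : LeftPath X) {x : X.carrier} (h : a.toMap 0 = x) :
    (HomotopyBigroupoid.mk x : HomotopyBigroupoid X.carrier) ⟶ HomotopyBigroupoid.mk X.pt :=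
  a.path h

/-- A 2-track from the constant left path to itself, as a 2-morphism of the homotopy bigroupoid. -/
def loop (α : LeftTrack (zero : LeftPath X) zero) :
    𝟙 (HomotopyBigroupoid.mk X.pt : HomotopyBigroupoid X.carrier) ⟶
      𝟙 (HomotopyBigroupoid.mk X.pt) :=
  LeftTrack.toTwoTrack rfl rfl α

end LeftPath

namespace LeftTrack

variable {a b : LeftPath X} {x : X.carrier}

theorem polar_psiInv (a : LeftPath X) (α : LeftCube (LeftPath.zero : LeftPath X) LeftPath.zero)
    (h : a.toMap 0 = x) :
    TwoTrack.mk ((LeftCube.psiInv a α).polar h h) =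
      _root_.psiInv (a.hom h) (LeftPath.loop (mk α)) := by
  subst h
  have h := a.concatZero_start
  have e : TwoTrack.mk ((LeftCube.psiInv a α).polar rfl rfl) =
      TwoTrack.comp (TwoTrack.comp (TwoTrack.mk ((LeftCube.stretch a).polar rfl h))
        (TwoTrack.mk ((LeftCube.graft a α).polar h h)))
        (TwoTrack.symm (TwoTrack.mk ((LeftCube.stretch a).polar rfl h))) := by
    unfold LeftCube.psiInv
    rw [LeftCube.polar_comp _ _ _ h, LeftCube.polar_comp _ _ _ h, LeftCube.polar_symm]
    rfl
  rw [e, LeftCube.polar_stretch, LeftCube.polar_graft]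
  refine (TwoTrack.assoc _ _ _).trans ?_
  exact congrArg (fun D => TwoTrack.comp (TwoTrack.rightUnitor (a.path rfl)).symm
    (TwoTrack.comp (TwoTrack.hcomp (TwoTrack.mk (Path.Homotopy.refl (a.path rfl)))
      (TwoTrack.mk (α.polar rfl rfl))) D)) (TwoTrack.symm_symm (TwoTrack.rightUnitor (a.path rfl)))

/-- The inverse of the structural isomorphism `ψ a`. -/
def psiInv (a : LeftPath X) :
    ((LeftPath.zero : LeftPath X) ⟶ LeftPath.zero) → (a ⟶ a) :=
  Quotient.map (LeftCube.psiInv a) (by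
    intro α β h
    refine (LeftCube.polar_rel_iff rfl rfl).1 (Quotient.exact
      (show TwoTrack.mk _ = TwoTrack.mk _ from ?_))
    have e : mk α = mk β := Quotient.sound h
    rw [polar_psiInv, polar_psiInv, e])

theorem toTwoTrack_psiInv (ha : a.toMap 0 = x) (α : (LeftPath.zero : LeftPath X) ⟶ LeftPath.zero) :
    toTwoTrack ha ha (psiInv a α) = _root_.psiInv (a.hom ha) (LeftPath.loop α) := by
  obtain ⟨α⟩ := α
  exact polar_psiInv a α ha

theorem psiInv_bijective (a : LeftPath X) : Function.Bijective (psiInv a) := by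
  have h := toTwoTrack_bijective (a := a) (b := a) rfl rfl
  have h' := toTwoTrack_bijective (a := (LeftPath.zero : LeftPath X)) (b := LeftPath.zero) rfl rfl
  have e : toTwoTrack rfl rfl ∘ psiInv a = _root_.psiInv (a.hom rfl) ∘ LeftPath.loop :=
    funext fun α => toTwoTrack_psiInv rfl α
  refine (h.of_comp_iff' (psiInv a)).1 ?_
  rw [e]
  exact (_root_.psiInv_bijective (a.hom rfl)).comp h'

theorem psiInv_comp (a : LeftPath X) (α β : (LeftPath.zero : LeftPath X) ⟶ LeftPath.zero) :
    psiInv a (α ≫ β) = psiInv a α ≫ psiInv a β := by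
  refine (toTwoTrack_bijective rfl rfl).1 ?_
  refine (toTwoTrack_psiInv rfl _).trans ?_
  refine Eq.trans ?_ (toTwoTrack_comp rfl rfl rfl _ _).symm
  rw [toTwoTrack_psiInv, toTwoTrack_psiInv]
  have e : LeftPath.loop (α ≫ β) = LeftPath.loop α ≫ LeftPath.loop β :=
    toTwoTrack_comp rfl rfl rfl α β
  rw [e]
  exact _root_.psiInv_comp _ _ _

theorem psiInv_natural (f : a ⟶ b) (α : (LeftPath.zero : LeftPath X) ⟶ LeftPath.zero) :
    psiInv a α ≫ f = f ≫ psiInv b α := by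
  have h := start_eq f
  refine (toTwoTrack_bijective h rfl).1 ?_
  refine (toTwoTrack_comp h h rfl _ _).trans ?_
  refine Eq.trans ?_ (toTwoTrack_comp h rfl rfl _ _).symm
  rw [toTwoTrack_psiInv, toTwoTrack_psiInv]
  exact _root_.psiInv_natural (a := a.hom h) (b := b.hom rfl) (toTwoTrack h rfl f) _

/-- The structural isomorphism `ψ a : Aut(a) ≅ Aut(0)`. -/
def psi (a : LeftPath X) : (a ⟶ a) ≃* ((LeftPath.zero : LeftPath X) ⟶ LeftPath.zero) :=
  (MulEquiv.mk' (Equiv.ofBijective _ (psiInv_bijective a)) (psiInv_comp a)).symm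

theorem psi_psiInv (a : LeftPath X) (α : (LeftPath.zero : LeftPath X) ⟶ LeftPath.zero) :
    psi a (psiInv a α) = α :=
  Equiv.ofBijective_symm_apply_apply _ (psiInv_bijective a) α

theorem psi_conj {a b : LeftPath X} (f : a ⟶ b) (α : b ⟶ b) :
    psi a (f ≫ α ≫ Groupoid.inv f) = psi b α := by
  obtain ⟨β, rfl⟩ := (psiInv_bijective b).2 α
  have h : f ≫ psiInv b β ≫ Groupoid.inv f = psiInv a β := by
    rw [← Category.assoc, ← psiInv_natural, Category.assoc, Groupoid.comp_inv, Category.comp_id]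
  rw [h, psi_psiInv, psi_psiInv]

end LeftTrack

namespace LeftPath

/-- The class of a left path in the star of the fundamental groupoid. -/
def star (a : LeftPath X) : GroupoidStar (FundamentalGroupoid X.carrier) ⟨X.pt⟩ :=
  ⟨⟨a.toMap 0⟩, Path.Homotopic.Quotient.mk (a.path rfl)⟩

theorem star_eq (a : LeftPath X) {x : X.carrier} (h : a.toMap 0 = x) :
    a.star = ⟨⟨x⟩, Path.Homotopic.Quotient.mk (a.path h)⟩ := by
  subst h
  rfl

theorem star_eq_iff {a b : LeftPath X} : a.star = b.star ↔ Nonempty (LeftCube a b) := by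
  constructor
  · intro h
    have h0 : a.toMap 0 = b.toMap 0 := congrArg (fun s => s.1.as) h
    rw [a.star_eq h0, b.star_eq rfl] at h
    obtain ⟨F⟩ := Path.Homotopic.Quotient.exact (eq_of_heq (Sigma.mk.inj h).2)
    obtain ⟨α, -⟩ := LeftCube.exists_polar h0 rfl F
    exact ⟨α⟩
  · rintro ⟨α⟩
    rw [a.star_eq α.start_eq, b.star_eq rfl]
    exact congrArg (Sigma.mk _) (Quotient.sound ⟨α.polar α.start_eq rfl⟩)

theorem star_surjective : Function.Surjective (star : LeftPath X → _) := by
  rintro ⟨⟨x⟩, ⟨p⟩⟩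
  exact ⟨⟨p.toContinuousMap, p.target⟩, star_eq _ p.source⟩

end LeftPath

/-- The fundamental 2-track groupoid of a pointed space. -/
def PointedSpace.twoTrackGroupoid (X : PointedSpace.{u}) : TwoTrackGroupoid.{u} where
  G₁ := FundamentalGroupoid X.carrier
  pt₁ := ⟨X.pt⟩
  G₂ := LeftPath X
  pt₂ := LeftPath.zero
  strictlyAbelian := ⟨LeftTrack.psi, LeftTrack.psi_conj⟩
  q := LeftPath.star
  q_pt := rfl
  q_const := by
    rintro a b ⟨e⟩
    obtain ⟨α, -⟩ := Quotient.exists_rep e.hom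
    exact LeftPath.star_eq_iff.2 ⟨α⟩
  q_bijective := by
    constructor
    · rintro ⟨a⟩ ⟨b⟩ h
      obtain ⟨α⟩ := LeftPath.star_eq_iff.1 h
      exact Quotient.sound ⟨(Groupoid.isoEquivHom a b).symm (LeftTrack.mk α)⟩
    · intro s
      obtain ⟨a, rfl⟩ := LeftPath.star_surjective s
      exact ⟨Quotient.mk _ a, rfl⟩

variable {Y : PointedSpace.{u}} (f : X ⟶ Y)

/-- The image of a left path under a pointed map. -/
def LeftPath.map (a : LeftPath X) : LeftPath Y where
  toMap := (PointedSpace.Hom.toMap f).comp a.toMap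
  map_one := (congrArg (PointedSpace.Hom.toMap f) a.map_one).trans (PointedSpace.Hom.map_pt f)

/-- The image of a left 2-cube under a pointed map. -/
def LeftCube.map {a b : LeftPath X} (α : LeftCube a b) : LeftCube (a.map f) (b.map f) where
  toMap := (PointedSpace.Hom.toMap f).comp α.toMap
  map_one_left t :=
    (congrArg (PointedSpace.Hom.toMap f) (α.map_one_left t)).trans (PointedSpace.Hom.map_pt f)
  map_one_right t :=
    (congrArg (PointedSpace.Hom.toMap f) (α.map_one_right t)).trans (PointedSpace.Hom.map_pt f)
  source t := congrArg (PointedSpace.Hom.toMap f) (α.source t)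
  target t := congrArg (PointedSpace.Hom.toMap f) (α.target t)

theorem LeftTrack.heq_mk {a b a' b' : LeftPath X} (α : LeftCube a b) (β : LeftCube a' b')
    (h : ∀ z, α.toMap z = β.toMap z) : HEq (mk α) (mk β) := by
  obtain rfl : a = a' := by
    ext t
    rw [← α.source, h, β.source]
  obtain rfl : b = b' := by
    ext t
    rw [← α.target, h, β.target]
  obtain rfl : α = β := by
    ext z
    exact h z
  rfl

/-- The image of a left 2-track under a pointed map. -/
def LeftTrack.map {a b : LeftPath X} : LeftTrack a b → LeftTrack (a.map f) (b.map f) :=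
  Quotient.map (LeftCube.map f) (fun _ _ h => h.comp_continuousMap (PointedSpace.Hom.toMap f))

/-- A left 2-cube whose boundary paths are replaced by equal ones. -/
def LeftCube.cast {a b a' b' : LeftPath X} (α : LeftCube a b) (h : a = a') (h' : b = b') :
    LeftCube a' b' where
  toMap := α.toMap
  map_one_left := α.map_one_left
  map_one_right := α.map_one_right
  source := h ▸ α.source
  target := h' ▸ α.target

theorem LeftPath.map_zero : (LeftPath.zero : LeftPath X).map f = LeftPath.zero := by
  ext t
  exact PointedSpace.Hom.map_pt f

/-- The functor on groupoids of left paths induced by a pointed map. -/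
def leftPathFunctor : LeftPath X ⥤ LeftPath Y where
  obj a := a.map f
  map α := LeftTrack.map f α
  map_id _ := rfl
  map_comp {a b c} α β := by
    obtain ⟨α⟩ := α
    obtain ⟨β⟩ := β
    refine eq_of_heq (LeftTrack.heq_mk ((α.comp β).map f) ((α.map f).comp (β.map f)) fun z => ?_)
    change PointedSpace.Hom.toMap f (LeftCube.glue α β (LeftCube.unfoldMap z)) =
      LeftCube.glue (α.map f) (β.map f) (LeftCube.unfoldMap z)
    unfold LeftCube.glue
    split_ifs <;> rfl

theorem LeftTrack.map_psiInv (a : LeftPath X)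
    (α : (LeftPath.zero : LeftPath X) ⟶ LeftPath.zero) :
    (leftPathFunctor f).map (psiInv a α) = psiInv (a.map f) (eqToHom (LeftPath.map_zero f).symm ≫
      (leftPathFunctor f).map α ≫ eqToHom (LeftPath.map_zero f)) := by
  obtain ⟨α⟩ := α
  have h := LeftPath.map_zero f
  have e : eqToHom h.symm ≫ (leftPathFunctor f).map (mk α) ≫ eqToHom h =
      mk ((α.map f).cast h h) :=
    ((conj_eqToHom_iff_heq' _ _ _ _).2 (heq_mk ((α.map f).cast h h) (α.map f) fun _ => rfl)).symm
  refine Eq.trans ?_ (congrArg (psiInv (a.map f)) e).symm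
  refine eq_of_heq (heq_mk ((LeftCube.psiInv a α).map f)
    (LeftCube.psiInv (a.map f) ((α.map f).cast h h)) fun z => ?_)
  have hs : ∀ z, PointedSpace.Hom.toMap f ((LeftCube.stretch a).toMap z) =
      (LeftCube.stretch (a.map f)).toMap z := fun _ => rfl
  have hg : ∀ z, PointedSpace.Hom.toMap f ((LeftCube.graft a α).toMap z) =
      (LeftCube.graft (a.map f) ((α.map f).cast h h)).toMap z := by
    intro z
    change PointedSpace.Hom.toMap f (LeftCube.graftMap a α _) = LeftCube.graftMap _ _ _
    unfold LeftCube.graftMap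
    split_ifs <;> rfl
  have hc : ∀ {b c d : LeftPath X} {b' c' d' : LeftPath Y} (β : LeftCube b c) (γ : LeftCube c d)
      (β' : LeftCube b' c') (γ' : LeftCube c' d')
      (_ : ∀ z, PointedSpace.Hom.toMap f (β.toMap z) = β'.toMap z)
      (_ : ∀ z, PointedSpace.Hom.toMap f (γ.toMap z) = γ'.toMap z) (z : I × I),
      PointedSpace.Hom.toMap f ((β.comp γ).toMap z) = (β'.comp γ').toMap z := by
    intro b c d b' c' d' β γ β' γ' h₁ h₂ z
    change PointedSpace.Hom.toMap f (LeftCube.glue β γ _) = LeftCube.glue β' γ' _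
    unfold LeftCube.glue
    split_ifs
    · exact h₁ _
    · exact h₂ _
  exact hc _ _ _ _ (hc _ _ _ _ hs hg) (fun z => hs (z.2, z.1)) z

theorem star_class_map {x₀ x₁ : X.carrier} {y : Y.carrier} (g : C(X.carrier, Y.carrier)) (h : g x₁ = y)
    (p : Path x₀ x₁) (p' : Path (g x₀) y) (hp : ∀ t, p' t = g (p t)) :
    (Path.Homotopic.Quotient.mk p' : (FundamentalGroupoid.mk (g x₀)) ⟶ FundamentalGroupoid.mk y) =
      (FundamentalGroupoid.map g).map (X := ⟨x₀⟩) (Y := ⟨x₁⟩) (Path.Homotopic.Quotient.mk p) ≫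
        eqToHom (congrArg FundamentalGroupoid.mk h) := by
  subst h
  obtain rfl : p' = p.map g.continuous := by
    ext t
    exact hp t
  exact (Category.comp_id (obj := FundamentalGroupoid Y.carrier) _).symm

theorem leftTrack_psi_map (a : LeftPath X) (α : a ⟶ a) :
    LeftTrack.psi (a.map f) ((leftPathFunctor f).map α) =
      eqToHom (LeftPath.map_zero f).symm ≫ (leftPathFunctor f).map (LeftTrack.psi a α) ≫
        eqToHom (LeftPath.map_zero f) := by
  obtain ⟨α, rfl⟩ := (LeftTrack.psiInv_bijective a).2 α
  rw [LeftTrack.map_psiInv, LeftTrack.psi_psiInv]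
  exact congrArg (fun β : (LeftPath.zero : LeftPath X) ⟶ LeftPath.zero =>
    eqToHom (LeftPath.map_zero f).symm ≫ (leftPathFunctor f).map β ≫
      eqToHom (LeftPath.map_zero f)) (LeftTrack.psi_psiInv a α).symm

/-- The morphism of fundamental 2-track groupoids induced by a pointed map. -/
def twoTrackGroupoidMap : X.twoTrackGroupoid ⟶ Y.twoTrackGroupoid :=
  TwoTrackGroupoid.Hom.mk (FundamentalGroupoid.map (PointedSpace.Hom.toMap f))
    (leftPathFunctor f) (congrArg FundamentalGroupoid.mk (PointedSpace.Hom.map_pt f))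
    (LeftPath.map_zero f) (leftTrack_psi_map f)
    (fun a => Sigma.ext rfl (heq_of_eq (star_class_map (PointedSpace.Hom.toMap f)
      (PointedSpace.Hom.map_pt f) (a.path rfl) ((a.map f).path rfl) fun _ => rfl)))

theorem leftPathFunctor_id : leftPathFunctor (𝟙 X) = 𝟭 (LeftPath X) := by
  refine Functor.hext (fun _ => rfl) ?_
  rintro a b ⟨α⟩
  exact HEq.rfl

theorem leftPathFunctor_comp {Z : PointedSpace.{u}} (g : Y ⟶ Z) :
    leftPathFunctor (f ≫ g) = leftPathFunctor f ⋙ leftPathFunctor g := by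
  refine Functor.hext (fun _ => rfl) ?_
  rintro a b ⟨α⟩
  exact HEq.rfl

/-- The fundamental 2-track groupoid as a functor on pointed spaces. -/
def fundamentalTwoTrackGroupoid : PointedSpace.{u} ⥤ TwoTrackGroupoid.{u} where
  obj X := X.twoTrackGroupoid
  map f := twoTrackGroupoidMap f
  map_id _ := TwoTrackGroupoid.hom_ext FundamentalGroupoid.map_id leftPathFunctor_id
  map_comp f g := TwoTrackGroupoid.hom_ext
    (FundamentalGroupoid.map_comp (PointedSpace.Hom.toMap g) (PointedSpace.Hom.toMap f))
    (leftPathFunctor_comp f g)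

end LeftTracks

/-!
The assignment `B ↦ B.underlying` is functorial because the composite of two pseudofunctors is
computed on objects, 1-morphisms and 2-morphisms by composing maps; the structure 2-isomorphisms
of the pseudofunctors do not enter. The equations `F x₀ = x₀'` of pointed homomorphisms only
contribute transports, which disappear after substituting the basepoint of the target.

For the comparison of the two functors on pointed spaces, a 1-morphism to the basepoint in the
homotopy bigroupoid is the same thing as a left path, and two paths are 2-isomorphic precisely if
they are homotopic. A left 2-cube, read in polar coordinates around the lower left corner of the
square, is a homotopy relative to end points from its left edge to its lower edge. This gives a
bijection between left 2-tracks and 2-tracks (`leftTrackEquiv`) which turns the composition of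
left 2-tracks into vertical composition, and attaching an automorphism of the constant left path to
the corner of the identity left 2-cube into whiskering conjugated by the right unitor
(`LeftTrack.toTwoTrack_psiInv`); hence it respects the isomorphisms `ψ`
(`leftPathComparison_psi`).

The morphism `comparison` goes from the underlying 2-track groupoid of the homotopy bigroupoid to
the fundamental 2-track groupoid: a left path is assigned to a path to the basepoint without
transport along its starting point, whereas a left 2-track only determines the equality of the
starting points of its two boundary left paths propositionally. Both functors underlying
`comparison` are fully faithful and bijective on objects, and this suffices for an isomorphism of
2-track groupoids (`TwoTrackGroupoid.isIso_of_bijective`). Naturality holds because all maps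
induced by a continuous map are given by composition with it.
-/

/-! ### Isomorphisms of 2-track groupoids -/

/-- A fully faithful functor which is bijective on objects has a strict inverse. -/
theorem exists_strict_inverse {C D : Type*} [Category* C] [Category* D] (F : C ⥤ D)
    (hF : F.FullyFaithful) (h : Function.Bijective F.obj) :
    ∃ G : D ⥤ C, F ⋙ G = 𝟭 C ∧ G ⋙ F = 𝟭 D := by
  let e := Equiv.ofBijective F.obj h
  have he : ∀ d, F.obj (e.symm d) = d := e.apply_symm_apply
  let G : D ⥤ C :=
    { obj := e.symm
      map {d d'} f := hF.preimage (eqToHom (he d) ≫ f ≫ eqToHom (he d').symm)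
      map_id d := hF.map_injective (by simp)
      map_comp f g := hF.map_injective (by simp) }
  have hG : G ⋙ F = 𝟭 D := CategoryTheory.Functor.ext he fun d d' f => by simp [G]
  have hc : ∀ c, (F ⋙ G).obj c = (𝟭 C).obj c := e.symm_apply_apply
  refine ⟨G, CategoryTheory.Functor.ext hc fun c c' f => ?_, hG⟩
  refine hF.map_injective ?_
  rw [F.map_comp, F.map_comp, eqToHom_map, eqToHom_map]
  simp [G]

namespace TwoTrackGroupoid

theorem psi_eqToHom (G : TwoTrackGroupoid.{u}) {a b : G.G₂} (h : a = b) (f : b ⟶ b) :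
    G.psi a (eqToHom h ≫ f ≫ eqToHom h.symm) = G.psi b f := by
  subst h
  simp

/-- A morphism is invertible as soon as its two functors are isomorphisms of categories: their
strict inverses automatically respect the remaining structure. -/
theorem isIso_of_bijective {G H : TwoTrackGroupoid.{u}} (F : G ⟶ H)
    (ff₁ : (Hom.F₁ F).FullyFaithful) (h₁ : Function.Bijective (Hom.F₁ F).obj)
    (ff₂ : (Hom.F₂ F).FullyFaithful) (h₂ : Function.Bijective (Hom.F₂ F).obj) : IsIso F := by
  obtain ⟨F₁, F₂, p₁, p₂, hψ, hq⟩ := F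
  obtain ⟨K₁, e₁, e₁'⟩ := exists_strict_inverse F₁ ff₁ h₁
  obtain ⟨K₂, e₂, e₂'⟩ := exists_strict_inverse F₂ ff₂ h₂
  have o₁ : ∀ x, K₁.obj (F₁.obj x) = x := Functor.congr_obj e₁
  have o₂ : ∀ a, K₂.obj (F₂.obj a) = a := Functor.congr_obj e₂
  have m₁ : ∀ {x y} (f : x ⟶ y), K₁.map (F₁.map f) = eqToHom (o₁ x) ≫ f ≫ eqToHom (o₁ y).symm :=
    fun f => Functor.congr_hom e₁ f
  have m₂ : ∀ {x y} (f : x ⟶ y), K₂.map (F₂.map f) = eqToHom (o₂ x) ≫ f ≫ eqToHom (o₂ y).symm :=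
    fun f => Functor.congr_hom e₂ f
  have p₁' : K₁.obj H.pt₁ = G.pt₁ := by rw [← p₁, o₁]
  have p₂' : K₂.obj H.pt₂ = G.pt₂ := by rw [← p₂, o₂]
  let K : H ⟶ G := Hom.mk K₁ K₂ p₁' p₂'
    (by
      intro a f
      obtain ⟨a, rfl⟩ := h₂.2 a
      obtain ⟨f, rfl⟩ := ff₂.map_surjective f
      rw [hψ a f, m₂, psi_eqToHom]
      simp [eqToHom_map, m₂])
    (by
      intro a
      obtain ⟨a, rfl⟩ := h₂.2 a
      rw [hq a, o₂]
      obtain ⟨x, f⟩ := G.q a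
      refine Sigma.ext (o₁ x).symm ?_
      simp [GroupoidStar.map, eqToHom_map, m₁])
  exact ⟨K, hom_ext e₁ e₂, hom_ext e₁' e₂'⟩

end TwoTrackGroupoid

/-! ### The forgetful functor -/

theorem piZeroFunctor_id (B : Type u) [Bicategory.{u, u} B] :
    piZeroFunctor (Pseudofunctor.id B) = 𝟭 (PiZero B) :=
  Functor.hext (fun _ => rfl) (by rintro x y ⟨f⟩; rfl)

theorem mappingFunctor_id {B : Type u} [Bicategory.{u, u} B] (p : B) :
    mappingFunctor (Pseudofunctor.id B) p = 𝟭 (MappingCoproduct p) :=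
  Functor.hext (fun _ => rfl) (by rintro _ _ ⟨f⟩; rfl)

theorem piZeroFunctor_comp {B C D : Type u} [Bicategory.{u, u} B] [Bicategory.{u, u} C]
    [Bicategory.{u, u} D] (F : Pseudofunctor B C) (G : Pseudofunctor C D) :
    piZeroFunctor (F.comp G) = piZeroFunctor F ⋙ piZeroFunctor G :=
  Functor.hext (fun _ => rfl) (by rintro x y ⟨f⟩; rfl)

theorem mappingFunctor_comp {B C D : Type u} [Bicategory.{u, u} B] [Bicategory.{u, u} C]
    [Bicategory.{u, u} D] (F : Pseudofunctor B C) (G : Pseudofunctor C D) (p : B) :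
    mappingFunctor (F.comp G) p = mappingFunctor F p ⋙ mappingFunctor G (F.obj p) :=
  Functor.hext (fun _ => rfl) (by rintro _ _ ⟨f⟩; rfl)

namespace PointedBigroupoid

theorem underlyingMap_id (B : PointedBigroupoid.{u}) : underlyingMap (𝟙 B) = 𝟙 B.underlying :=
  (Category.comp_id _).trans
    (TwoTrackGroupoid.hom_ext (piZeroFunctor_id B.carrier) (mappingFunctor_id B.pt))

theorem underlyingMap_comp {B C D : PointedBigroupoid.{u}} (F : B ⟶ C) (G : C ⟶ D) :
    underlyingMap (F ≫ G) = underlyingMap F ≫ underlyingMap G := by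
  -- The chosen objects of `C` and `D` are made variables, so that they can be replaced by the
  -- images of `B.pt` and the transports in `underlyingMap` become identities.
  obtain ⟨C, pC⟩ := C
  obtain ⟨D, pD⟩ := D
  obtain ⟨F, hF, hF'⟩ := F
  obtain ⟨G, hG, hG'⟩ := G
  change Pseudofunctor B.carrier C at F
  change Pseudofunctor C D at G
  obtain rfl : F.obj B.pt = pC := hF
  obtain rfl : G.obj (F.obj B.pt) = pD := hG
  refine (Category.comp_id _).trans (Eq.trans ?_
    (congrArg₂ (· ≫ ·) (Category.comp_id _) (Category.comp_id _)).symm)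
  exact TwoTrackGroupoid.hom_ext (piZeroFunctor_comp F G) (mappingFunctor_comp F G B.pt)

/-- The forgetful functor from pointed bigroupoids to 2-track groupoids. -/
noncomputable def forgetful : PointedBigroupoid.{u} ⥤ TwoTrackGroupoid.{u} where
  obj B := B.underlying
  map F := underlyingMap F
  map_id := underlyingMap_id
  map_comp := underlyingMap_comp

end PointedBigroupoid

/-! ### Comparison of the two 2-track groupoids of a pointed space -/

noncomputable section Comparison

open PathTrack

variable (X : PointedSpace.{u})

/-- The isomorphism of groupoids from `π₀` of the homotopy bigroupoid to the fundamental groupoid: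
two paths are 2-isomorphic precisely if they are homotopic. -/
def piZeroComparison :
    PiZero (HomotopyBigroupoid X.carrier) ⥤ FundamentalGroupoid X.carrier where
  obj x := ⟨x.as.as⟩
  map {x y} := Quotient.map' (s₂ := Path.Homotopic.setoid x.as.as y.as.as) (fun p => p) (by
    rintro p q ⟨e⟩
    obtain ⟨F, -⟩ := Quotient.exists_rep (show TwoTrack (X := X.carrier) p q from e.hom)
    exact ⟨F⟩)
  map_id _ := rfl
  map_comp := by
    rintro x y z ⟨p⟩ ⟨q⟩
    rfl

theorem piZeroComparison_bijective (x y : PiZero (HomotopyBigroupoid X.carrier)) :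
    Function.Bijective ((piZeroComparison X).map : (x ⟶ y) → _) := by
  constructor
  · rintro ⟨p⟩ ⟨q⟩ h
    obtain ⟨F⟩ := Path.Homotopic.Quotient.exact h
    exact Quotient.sound ⟨HomotopyBigroupoid.isoMk (TwoTrack.mk F)⟩
  · rintro ⟨p⟩
    exact ⟨PiZero.homMk p, rfl⟩

variable {X}

/-- A 1-morphism of the homotopy bigroupoid to the basepoint, as a left path. -/
def leftPathOf (a : MappingCoproduct (HomotopyBigroupoid.mk X.pt)) : LeftPath X :=
  ⟨Path.toContinuousMap a.2, Path.target a.2⟩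

theorem leftPathOf_bijective : Function.Bijective (leftPathOf (X := X)) := by
  constructor
  · rintro ⟨⟨x⟩, p⟩ ⟨⟨y⟩, q⟩ h
    change Path x X.pt at p
    change Path y X.pt at q
    have h' : ∀ t, p t = q t := fun t => congrArg (fun a : LeftPath X => a.toMap t) h
    obtain rfl : x = y := p.source.symm.trans ((h' 0).trans q.source)
    obtain rfl : p = q := Path.ext (funext h')
    rfl
  · intro a
    exact ⟨⟨⟨a.toMap 0⟩, a.hom rfl⟩, rfl⟩

/-- Left 2-tracks between the left paths of two parallel paths are the 2-tracks between these
paths: the left edge and the lower edge of the square are the two extreme angles of polar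
coordinates centred at the lower left corner. -/
def leftTrackEquiv {x : X.carrier} (p q : Path x X.pt) :
    (leftPathOf ⟨⟨x⟩, p⟩ ⟶ leftPathOf ⟨⟨x⟩, q⟩) ≃ TwoTrack p q :=
  Equiv.ofBijective _ (LeftTrack.toTwoTrack_bijective p.source q.source)

theorem leftTrackEquiv_id {x : X.carrier} (p : Path x X.pt) :
    leftTrackEquiv p p (𝟙 _) = TwoTrack.mk (Path.Homotopy.refl p) :=
  LeftTrack.toTwoTrack_id p.source

theorem leftTrackEquiv_comp {x : X.carrier} {p q r : Path x X.pt}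
    (α : leftPathOf ⟨⟨x⟩, p⟩ ⟶ leftPathOf ⟨⟨x⟩, q⟩)
    (β : leftPathOf ⟨⟨x⟩, q⟩ ⟶ leftPathOf ⟨⟨x⟩, r⟩) :
    leftTrackEquiv p r (α ≫ β) = (leftTrackEquiv p q α).comp (leftTrackEquiv q r β) :=
  LeftTrack.toTwoTrack_comp p.source q.source r.source α β

variable (X)

/-- The isomorphism of groupoids from the coproduct of the groupoids of paths to the basepoint to
the groupoid of left paths. -/
def leftPathComparison : MappingCoproduct (HomotopyBigroupoid.mk X.pt) ⥤ LeftPath X where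
  obj := leftPathOf
  map
    | Sigma.SigmaHom.mk f => (leftTrackEquiv _ _).symm f
  map_id := by
    rintro ⟨x, p⟩
    exact (Equiv.symm_apply_eq _).2 (leftTrackEquiv_id p).symm
  map_comp := by
    rintro _ _ _ ⟨f⟩ ⟨g⟩
    refine (Equiv.symm_apply_eq _).2 ?_
    rw [leftTrackEquiv_comp, Equiv.apply_symm_apply, Equiv.apply_symm_apply]
    rfl

theorem leftPathComparison_bijective (a b : MappingCoproduct (HomotopyBigroupoid.mk X.pt)) :
    Function.Bijective ((leftPathComparison X).map : (a ⟶ b) → _) := by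
  constructor
  · rintro ⟨f⟩ g h
    obtain ⟨g, rfl⟩ := (mappingHom_bijective _ _).2 g
    exact congrArg mappingHom ((leftTrackEquiv _ _).symm.injective h)
  · intro α
    obtain ⟨⟨x⟩, p⟩ := a
    obtain ⟨⟨y⟩, q⟩ := b
    obtain rfl : x = y := p.source.symm.trans ((LeftTrack.start_eq α).trans q.source)
    exact ⟨mappingHom (leftTrackEquiv p q α), (leftTrackEquiv p q).symm_apply_apply α⟩

/-- Both isomorphisms `ψ` are determined by their inverses, which `leftTrackEquiv` identifies. -/
theorem leftPathComparison_psi (a : MappingCoproduct (HomotopyBigroupoid.mk X.pt)) (f : a ⟶ a) :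
    LeftTrack.psi (leftPathOf a) ((leftPathComparison X).map f) =
      (leftPathComparison X).map (psiEquiv a.2 f) := by
  obtain ⟨⟨x⟩, p⟩ := a
  obtain ⟨f, rfl⟩ := (mappingHom_bijective _ _).2 f
  obtain ⟨α, rfl⟩ := (psiInv_bijective p).2 f
  rw [psiEquiv_psiInv]
  obtain ⟨β, rfl⟩ := (leftTrackEquiv (Path.refl X.pt) (Path.refl X.pt)).surjective α
  have h : (leftPathComparison X).map (mappingHom (psiInv p (leftTrackEquiv (Path.refl X.pt)
      (Path.refl X.pt) β))) = LeftTrack.psiInv (leftPathOf ⟨⟨x⟩, p⟩) β :=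
    (Equiv.symm_apply_eq _).2 (LeftTrack.toTwoTrack_psiInv (a := leftPathOf ⟨⟨x⟩, p⟩)
      (Path.source p) β).symm
  refine (congrArg _ h).trans ((LeftTrack.psi_psiInv _ β).trans ?_)
  exact ((leftTrackEquiv _ _).symm_apply_apply β).symm

/-- The comparison of the 2-track groupoid underlying the homotopy bigroupoid with the fundamental
2-track groupoid. In this direction both functors preserve the chosen objects definitionally. -/
def comparison : (homotopyBigroupoid.obj X).underlying ⟶ X.twoTrackGroupoid :=
  TwoTrackGroupoid.Hom.mk (piZeroComparison X) (leftPathComparison X) rfl rfl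
    (fun a f => (leftPathComparison_psi X a f).trans
      ((Category.id_comp _).trans (Category.comp_id _)).symm)
    (fun a => (LeftPath.star_eq _ (Path.source a.2)).trans
      (Sigma.ext rfl (heq_of_eq (Category.comp_id _).symm)))

theorem isIso_comparison : IsIso (comparison X) := by
  refine TwoTrackGroupoid.isIso_of_bijective _
    ⟨fun f => (Equiv.ofBijective _ (piZeroComparison_bijective X _ _)).symm f, ?_, ?_⟩ ?_
    ⟨fun f => (Equiv.ofBijective _ (leftPathComparison_bijective X _ _)).symm f, ?_, ?_⟩
    leftPathOf_bijective
  · exact fun f => Equiv.ofBijective_apply_symm_apply _ _ f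
  · exact fun f => Equiv.ofBijective_symm_apply_apply _ _ f
  · exact ⟨fun x y h => congrArg (fun z : FundamentalGroupoid X.carrier =>
      PiZero.mk (HomotopyBigroupoid.mk z.as)) h,
      fun x => ⟨PiZero.mk (HomotopyBigroupoid.mk x.as), rfl⟩⟩
  · exact fun f => Equiv.ofBijective_apply_symm_apply _ _ f
  · exact fun f => Equiv.ofBijective_symm_apply_apply _ _ f

/-- The comparison as an isomorphism of 2-track groupoids. -/
def comparisonIso : (homotopyBigroupoid.obj X).underlying ≅ X.twoTrackGroupoid :=
  haveI := isIso_comparison X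
  asIso (comparison X)

variable {X}

theorem leftTrackEquiv_map {Y : Type u} [TopologicalSpace Y] (f : C(X.carrier, Y)) {x : X.carrier}
    (p q : Path x X.pt) (α : leftPathOf ⟨⟨x⟩, p⟩ ⟶ leftPathOf ⟨⟨x⟩, q⟩) :
    leftTrackEquiv (X := ⟨Y, f X.pt⟩) (p.map f.continuous) (q.map f.continuous)
      ((leftPathFunctor (Y := ⟨Y, f X.pt⟩) ⟨f, rfl⟩).map α) =
        HomotopyBigroupoid.mapTwoTrack f (leftTrackEquiv p q α) := by
  obtain ⟨α⟩ := α
  exact eq_of_heq (HomotopyBigroupoid.heq_mk _ _ fun _ => rfl)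

theorem comparison_natural {Y : PointedSpace.{u}} (f : X ⟶ Y) :
    PointedBigroupoid.underlyingMap (homotopyBigroupoid.map f) ≫ comparison Y =
      comparison X ≫ twoTrackGroupoidMap f := by
  -- With the basepoint of the target replaced by `f X.pt`, no transport is left.
  obtain ⟨Y, pY⟩ := Y
  obtain ⟨f, hf⟩ := f
  change C(X.carrier, Y) at f
  obtain rfl : f X.pt = pY := hf
  refine (congrArg (· ≫ comparison _) (Category.comp_id _)).trans ?_
  refine TwoTrackGroupoid.hom_ext (Functor.hext (fun _ => rfl) ?_) (Functor.hext (fun _ => rfl) ?_)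
  · rintro x y ⟨p⟩
    rfl
  · rintro _ _ ⟨g⟩
    rename_i x p q
    change Path x.as X.pt at p
    change Path x.as X.pt at q
    refine heq_of_eq ((Equiv.symm_apply_eq _).2 (Eq.trans ?_ (leftTrackEquiv_map f p q _).symm))
    exact congrArg (HomotopyBigroupoid.mapTwoTrack f) ((leftTrackEquiv p q).apply_symm_apply g).symm

end Comparison

theorem mainTheorem10 :
    ∃ U : PointedBigroupoid.{u} ⥤ TwoTrackGroupoid.{u},
      (∃ hobj : ∀ B : PointedBigroupoid.{u}, U.obj B = B.underlying,
        ∀ {B C : PointedBigroupoid.{u}} (F : B ⟶ C),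
          U.map F = eqToHom (hobj B) ≫ PointedBigroupoid.underlyingMap F ≫
            eqToHom (hobj C).symm) ∧
      Nonempty (fundamentalTwoTrackGroupoid.{u} ≅ homotopyBigroupoid.{u} ⋙ U) := by
  refine ⟨PointedBigroupoid.forgetful, ⟨fun _ => rfl, fun F => ?_⟩, ?_⟩
  · exact ((Category.id_comp _).trans (Category.comp_id _)).symm
  · exact ⟨(NatIso.ofComponents (fun X => comparisonIso X) comparison_natural).symm⟩
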